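/- Let $\mathbb{G}$ be a Carnot group written in global coordinates: $\mathbb{G}=\mathbb{R}^n$ with a smooth Lie group operation whose Lie algebra $\mathfrak g$ (of left invariant vector fields) has a stratification $\mathfrak g=V_1\oplus\dots\oplus V_s$, that is, $[V_1,V_k]=V_{k+1}$ for $1\le k<s$, $[V_1,V_s]=0$ and $V_s\neq 0$. Fix a basis $X_1,\dots,X_m$ of $V_1$. A curve $\gamma\colon[a,b]\to\mathbb{R}^n$ is horizontal if it is absolutely continuous and there are $u_1,\dots,u_m\in L^1([a,b])$ with $\gamma'(t)=\sum_{i=1}^m u_i(t)X_i(\gamma(t))$ for almost every $t\in[a,b]$; its length is $\int_a^b\sqrt{u_1^2+\dots+u_m^2}\,dt$. The Carnot–Carathéodory distance $d_c(x,y)$ is the infimum of the lengths of the horizontal curves joining $x$ to $y$. A Lipschitz curve is a map $\gamma\colon[0,1]\to\mathbb{G}$ that is Lipschitz with respect to $d_c$. A $C^1_H$ curve is a horizontal curve that is $C^1$ as a curve in $\mathbb{R}^n$. Let $|A|$ denote the Lebesgue measure of $A\subset\mathbb{R}$, and let $\mathcal{H}^1$ be the 1-dimensional Hausdorff measure with respect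 to $d_c$. A set $E\subset\mathbb{G}$ is purely $C^1_H$ 1-unrectifiable if $\mathcal{H}^1(E\cap\Gamma([0,1]))=0$ for every $C^1_H$ curve $\Gamma\colon[0,1]\to\mathbb{G}$. **Theorem.** Let $\gamma\colon[0,1]\to\mathbb{G}$ be a Lipschitz curve such that $$\bigl|\{t\in[0,1]:\Gamma(t)=\gamma(t)\}\bigr|=0$$ for every $C^1_H$ curve $\Gamma\colon[0,1]\to\mathbb{G}$. Then $\gamma([0,1])$ is purely $C^1_H$ 1-unrectifiable. -/

import Mathlib

open MeasureTheory Set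
open scoped Manifold ContDiff NNReal ENNReal

noncomputable section

namespace Carnot

/-! ### Lie groups on a Euclidean space, left invariant fields, stratifications

A Carnot group in global coordinates is a Lie group operation on a finite-dimensional real vector
space `E` (such as `ℝⁿ`), that is `[Group E]` together with `[LieGroup 𝓘(ℝ, E) ∞ E]`, whose Lie
algebra `GroupLieAlgebra 𝓘(ℝ, E) E` (the tangent space at the identity, with the bracket of left
invariant vector fields) is stratified. -/

section Basic

variable {E : Type*} [NormedAddCommGroup E] [NormedSpace ℝ E] [Group E]

/-- The left invariant vector field on `E` with value `v` at the group identity. -/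
def leftField (v : GroupLieAlgebra 𝓘(ℝ, E) E) (x : E) : E :=
  mulInvariantVectorField v x

/-- The left invariant field at `x` is the differential of left multiplication by `x`, at the
identity, applied to `v`. -/
theorem leftField_eq_fderiv (v : GroupLieAlgebra 𝓘(ℝ, E) E) (x : E) :
    leftField v x = fderiv ℝ (fun y : E => x * y) 1 v := by
  unfold leftField mulInvariantVectorField
  rw [mfderiv_eq_fderiv]
  rfl

/-- `V 1, …, V s` is a stratification of step `s` of the Lie algebra `𝔤` of the group:
`𝔤 = V 1 ⊕ ⋯ ⊕ V s`, `[V 1, V k] = V (k + 1)` for `1 ≤ k < s`, `[V 1, V s] = 0`, `V s ≠ 0`.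
(The terms of the sequence with index outside `1, …, s` are zero by convention.) -/
structure IsStratification (s : ℕ) (V : ℕ → Submodule ℝ (GroupLieAlgebra 𝓘(ℝ, E) E)) : Prop where
  one_le : 1 ≤ s
  eq_bot : ∀ k, k ∉ Icc 1 s → V k = ⊥
  isInternal : DirectSum.IsInternal V
  bracket : ∀ k ∈ Icc 1 s, Submodule.span ℝ {z | ∃ v ∈ V 1, ∃ w ∈ V k, ⁅v, w⁆ = z} = V (k + 1)
  top_ne_bot : V s ≠ ⊥

variable {ι : Type*} [Fintype ι]

/-! ### Horizontal curves

`X` is the fixed family of vectors that spans the horizontal layer. Curves on `[a, b]` are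
functions on `ℝ` of which only the values on `[a, b]` matter. -/

/-- `γ` is absolutely continuous on `[a, b]`, the controls `u i` are in `L¹([a, b])`, and
`γ' = ∑ i, u i • X i (γ)` almost everywhere on `[a, b]`. -/
structure IsHorizontalWith (X : ι → GroupLieAlgebra 𝓘(ℝ, E) E) (γ : ℝ → E) (a b : ℝ)
    (u : ι → ℝ → ℝ) : Prop where
  absCont : AbsolutelyContinuousOnInterval γ a b
  integrable : ∀ i, IntervalIntegrable (u i) volume a b
  hasDerivAt : ∀ᵐ t ∂volume, t ∈ uIcc a b →
    HasDerivAt γ (∑ i, u i t • leftField (X i) (γ t)) t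

/-- A horizontal curve on `[a, b]`. -/
def IsHorizontal (X : ι → GroupLieAlgebra 𝓘(ℝ, E) E) (γ : ℝ → E) (a b : ℝ) : Prop :=
  ∃ u : ι → ℝ → ℝ, IsHorizontalWith X γ a b u

/-- The horizontal speed `√(∑ i, u i ^ 2)`. -/
def speed (u : ι → ℝ → ℝ) (t : ℝ) : ℝ := √(∑ i, u i t ^ 2)

/-- A `C¹_H` curve on `[a, b]`: horizontal, and `C¹` as a curve in the vector space `E`
(one-sided derivatives at the end points). -/
def IsC1H (X : ι → GroupLieAlgebra 𝓘(ℝ, E) E) (γ : ℝ → E) (a b : ℝ) : Prop :=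
  IsHorizontal X γ a b ∧ ContDiffOn ℝ 1 γ (Icc a b)

/-- The Carnot-Carathéodory distance: the infimum of the lengths `∫ |γ'|_H` of the horizontal
curves that join `x` to `y` (`⊤` if there are none). -/
def ccDist (X : ι → GroupLieAlgebra 𝓘(ℝ, E) E) (x y : E) : ℝ≥0∞ :=
  sInf {l | ∃ (a b : ℝ) (γ : ℝ → E) (u : ι → ℝ → ℝ), a ≤ b ∧ IsHorizontalWith X γ a b u ∧
    γ a = x ∧ γ b = y ∧ l = ENNReal.ofReal (∫ t in a..b, speed u t)}

/-! ### The distance is an extended metric -/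

theorem speed_nonneg (u : ι → ℝ → ℝ) (t : ℝ) : 0 ≤ speed u t := Real.sqrt_nonneg _

theorem abs_le_speed (u : ι → ℝ → ℝ) (t : ℝ) (i : ι) : |u i t| ≤ speed u t :=
  Real.abs_le_sqrt (Finset.single_le_sum (f := fun i => u i t ^ 2)
    (fun _ _ => sq_nonneg _) (Finset.mem_univ i))

theorem speed_le_sum (u : ι → ℝ → ℝ) (t : ℝ) : speed u t ≤ ∑ i, |u i t| := by
  refine Real.sqrt_le_iff.2 ⟨Finset.sum_nonneg fun i _ => abs_nonneg _, ?_⟩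
  simpa [sq_abs] using Finset.sum_sq_le_sq_sum_of_nonneg
    (s := Finset.univ) (f := fun i => |u i t|) (fun i _ => abs_nonneg _)

theorem intervalIntegrable_speed {u : ι → ℝ → ℝ} {a b : ℝ}
    (h : ∀ i, IntervalIntegrable (u i) volume a b) : IntervalIntegrable (speed u) volume a b := by
  have hs : IntervalIntegrable (fun t => ∑ i, |u i t|) volume a b := by
    have := IntervalIntegrable.sum (μ := volume) (a := a) (b := b) Finset.univ
      (f := fun i t => |u i t|) (fun i _ => (h i).abs)
    have e : (∑ i, fun t => |u i t|) = fun t => ∑ i, |u i t| := by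
      funext t
      simp
    rwa [e] at this
  refine hs.mono_fun ?_ (Filter.Eventually.of_forall fun t => ?_)
  · have : ∀ i, AEStronglyMeasurable (u i) (volume.restrict (uIoc a b)) :=
      fun i => (intervalIntegrable_iff.1 (h i)).aestronglyMeasurable
    refine Real.continuous_sqrt.comp_aestronglyMeasurable ?_
    exact Finset.aestronglyMeasurable_fun_sum _ fun i _ => (this i).pow 2
  · beta_reduce
    rw [Real.norm_of_nonneg (speed_nonneg u t),
      Real.norm_of_nonneg (Finset.sum_nonneg fun i _ => abs_nonneg _)]
    exact speed_le_sum u t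

/-- Absolute continuity is stable under 1-Lipschitz monotone (or antitone) reparametrisation. -/
theorem absCont_comp {F : Type*} [PseudoMetricSpace F] {f : ℝ → F} {φ : ℝ → ℝ} {a b c d : ℝ}
    (hf : AbsolutelyContinuousOnInterval f c d)
    (hφ : ∀ x ∈ uIcc a b, φ x ∈ uIcc c d) (hl : ∀ x y, dist (φ x) (φ y) ≤ dist x y)
    (hm : Monotone φ ∨ Antitone φ) : AbsolutelyContinuousOnInterval (f ∘ φ) a b := by
  rw [absolutelyContinuousOnInterval_iff] at hf ⊢
  intro ε hε
  obtain ⟨δ, hδ, H⟩ := hf ε hε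
  refine ⟨δ, hδ, fun I hI hsum => ?_⟩
  refine H (I.1, fun i => (φ (I.2 i).1, φ (I.2 i).2)) ⟨?_, ?_⟩ ?_
  · intro i hi
    exact ⟨hφ _ (hI.1 i hi).1, hφ _ (hI.1 i hi).2⟩
  · intro i hi j hj hij
    have hd := hI.2 hi hj hij
    simp only [Function.onFun, uIoc, Ioc_disjoint_Ioc] at hd ⊢
    rcases hm with hm | hm
    · rw [← hm.map_min, ← hm.map_min, ← hm.map_max, ← hm.map_max, ← hm.map_min, ← hm.map_max]
      exact hm hd
    · rw [← hm.map_max, ← hm.map_max, ← hm.map_min, ← hm.map_min, ← hm.map_max, ← hm.map_min]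
      exact hm hd
  · exact (Finset.sum_le_sum fun i _ => hl _ _).trans_lt hsum

theorem IsHorizontalWith.shift {X : ι → GroupLieAlgebra 𝓘(ℝ, E) E} {γ : ℝ → E} {c d : ℝ}
    {u : ι → ℝ → ℝ} (h : IsHorizontalWith X γ c d u) (r : ℝ) :
    IsHorizontalWith X (fun t => γ (t + r)) (c - r) (d - r) (fun i t => u i (t + r)) where
  absCont := by
    refine absCont_comp (φ := fun t => t + r) h.absCont (fun x hx => ?_) (fun x y => by simp)
      (Or.inl fun x y hxy => by simpa using hxy)
    simp only [mem_uIcc] at hx ⊢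
    grind
  integrable i := (h.integrable i).comp_add_right r
  hasDerivAt := by
    have := (measurePreserving_add_right volume r).quasiMeasurePreserving.ae h.hasDerivAt
    filter_upwards [this] with t ht hmem
    refine (ht ?_).comp_add_const t r
    simp only [mem_uIcc] at hmem ⊢
    grind

theorem IsHorizontalWith.reverse {X : ι → GroupLieAlgebra 𝓘(ℝ, E) E} {γ : ℝ → E} {c d : ℝ}
    {u : ι → ℝ → ℝ} (h : IsHorizontalWith X γ c d u) :
    IsHorizontalWith X (fun t => γ (-t)) (-d) (-c) (fun i t => -u i (-t)) where
  absCont := by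
    refine absCont_comp (φ := fun t => -t) h.absCont (fun x hx => ?_)
      (fun x y => by simp) (Or.inr fun x y hxy => by simpa using hxy)
    simp only [mem_uIcc] at hx ⊢
    grind
  integrable i := by
    have := ((IntervalIntegrable.iff_comp_neg (by finiteness)).1 (h.integrable i)).symm
    exact this.neg
  hasDerivAt := by
    have := (Measure.measurePreserving_neg (volume : Measure ℝ)).quasiMeasurePreserving.ae
      h.hasDerivAt
    filter_upwards [this] with t ht hmem
    have := (ht (by simp only [mem_uIcc] at hmem ⊢; grind)).scomp t (hasDerivAt_neg t)
    have e : (∑ i, (-u i (-t)) • leftField (X i) (γ (-t))) =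
        (-1 : ℝ) • ∑ i, u i (-t) • leftField (X i) (γ (-t)) := by
      rw [Finset.smul_sum]
      exact Finset.sum_congr rfl fun i _ => by rw [smul_smul, neg_one_mul]
    rw [e]
    exact this

theorem IsHorizontalWith.concat {X : ι → GroupLieAlgebra 𝓘(ℝ, E) E} {γ₁ γ₂ : ℝ → E} {a b c : ℝ}
    {u₁ u₂ : ι → ℝ → ℝ} (hab : a ≤ b) (hbc : b ≤ c) (h₁ : IsHorizontalWith X γ₁ a b u₁)
    (h₂ : IsHorizontalWith X γ₂ b c u₂) (hb : γ₁ b = γ₂ b) :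
    IsHorizontalWith X (fun t => if t ≤ b then γ₁ t else γ₂ t) a c
      (fun i t => if t ≤ b then u₁ i t else u₂ i t) where
  absCont := by
    have e : (fun t => if t ≤ b then γ₁ t else γ₂ t) =
        fun t => (γ₁ ∘ fun t => min t b) t + (γ₂ ∘ fun t => max t b) t - γ₂ b := by
      funext t
      by_cases ht : t ≤ b
      · simp [ht]
      · simp [ht, (not_le.1 ht).le, hb]
    rw [e]
    have A : AbsolutelyContinuousOnInterval (γ₁ ∘ fun t => min t b) a c := by
      refine absCont_comp h₁.absCont (fun x hx => ?_) (fun x y => ?_)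
        (Or.inl fun x y hxy => min_le_min_right b hxy)
      · simp only [mem_uIcc] at hx ⊢
        grind
      · simpa [Real.dist_eq] using abs_min_sub_min_le_max x b y b
    have B : AbsolutelyContinuousOnInterval (γ₂ ∘ fun t => max t b) a c := by
      refine absCont_comp h₂.absCont (fun x hx => ?_) (fun x y => ?_)
        (Or.inl fun x y hxy => max_le_max_right b hxy)
      · simp only [mem_uIcc] at hx ⊢
        grind
      · simpa [Real.dist_eq] using abs_max_sub_max_le_max x b y b
    have C : AbsolutelyContinuousOnInterval (fun _ : ℝ => γ₂ b) a c :=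
      (LipschitzWith.const (γ₂ b)).lipschitzOnWith.absolutelyContinuousOnInterval
    exact (A.add B).sub C
  integrable i := by
    refine IntervalIntegrable.trans (b := b) ?_ ?_
    · refine (h₁.integrable i).congr ?_
      intro t ht
      rw [uIoc_of_le hab] at ht
      simp [ht.2]
    · refine (h₂.integrable i).congr ?_
      intro t ht
      rw [uIoc_of_le hbc] at ht
      simp [not_le.2 ht.1]
  hasDerivAt := by
    have hne : ∀ᵐ t : ℝ ∂volume, t ≠ b := by simp [ae_iff]
    filter_upwards [h₁.hasDerivAt, h₂.hasDerivAt, hne] with t ht₁ ht₂ hne hmem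
    rw [uIcc_of_le (hab.trans hbc)] at hmem
    rcases lt_or_gt_of_ne hne with hlt | hlt
    · have := ht₁ (by rw [uIcc_of_le hab]; exact ⟨hmem.1, hlt.le⟩)
      simp only [hlt.le, if_true]
      refine this.congr_of_eventuallyEq ?_
      filter_upwards [Iio_mem_nhds hlt] with s hs
      simp [(mem_Iio.1 hs).le]
    · have := ht₂ (by rw [uIcc_of_le hbc]; exact ⟨hlt.le, hmem.2⟩)
      simp only [not_le.2 hlt, if_false]
      refine this.congr_of_eventuallyEq ?_
      filter_upwards [Ioi_mem_nhds hlt] with s hs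
      simp [not_le.2 (mem_Ioi.1 hs)]

theorem ccDist_le {X : ι → GroupLieAlgebra 𝓘(ℝ, E) E} {γ : ℝ → E} {a b : ℝ} {u : ι → ℝ → ℝ}
    (hab : a ≤ b) (h : IsHorizontalWith X γ a b u) :
    ccDist X (γ a) (γ b) ≤ ENNReal.ofReal (∫ t in a..b, speed u t) :=
  sInf_le ⟨a, b, γ, u, hab, h, rfl, rfl, rfl⟩

theorem ccDist_self (X : ι → GroupLieAlgebra 𝓘(ℝ, E) E) (x : E) : ccDist X x x = 0 := by
  have h : IsHorizontalWith X (fun _ : ℝ => x) 0 0 (fun _ _ => 0) :=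
    ⟨(LipschitzWith.const x).lipschitzOnWith.absolutelyContinuousOnInterval, by simp,
      Filter.Eventually.of_forall fun t _ => by simpa using hasDerivAt_const t x⟩
  simpa using ccDist_le le_rfl h

theorem ccDist_comm_le (X : ι → GroupLieAlgebra 𝓘(ℝ, E) E) (x y : E) :
    ccDist X y x ≤ ccDist X x y := by
  refine le_sInf ?_
  rintro l ⟨a, b, γ, u, hab, h, rfl, rfl, rfl⟩
  have := ccDist_le (neg_le_neg hab) h.reverse
  simp only [neg_neg] at this
  refine this.trans (le_of_eq ?_)
  congr 1
  have e : (speed fun i t => -u i (-t)) = fun t => speed u (-t) := by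
    funext t
    simp [speed]
  rw [e, intervalIntegral.integral_comp_neg]
  simp

theorem ccDist_comm (X : ι → GroupLieAlgebra 𝓘(ℝ, E) E) (x y : E) :
    ccDist X x y = ccDist X y x :=
  le_antisymm (ccDist_comm_le X y x) (ccDist_comm_le X x y)

theorem ccDist_triangle (X : ι → GroupLieAlgebra 𝓘(ℝ, E) E) (x y z : E) :
    ccDist X x z ≤ ccDist X x y + ccDist X y z := by
  have key : ∀ l₁ ∈ {l | ∃ (a b : ℝ) (γ : ℝ → E) (u : ι → ℝ → ℝ), a ≤ b ∧
      IsHorizontalWith X γ a b u ∧ γ a = x ∧ γ b = y ∧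
      l = ENNReal.ofReal (∫ t in a..b, speed u t)}, ccDist X x z ≤ l₁ + ccDist X y z := by
    rintro l₁ ⟨a, b, γ₁, u₁, hab, h₁, rfl, rfl, rfl⟩
    rw [ccDist.eq_1 X (γ₁ b) z, ENNReal.add_sInf]
    refine le_iInf₂ ?_
    rintro l₂ ⟨c, d, γ₂, u₂, hcd, h₂, h₂c, rfl, rfl⟩
    have h₃ := h₂.shift (c - b)
    rw [sub_sub_cancel] at h₃
    have hbc : b ≤ d - (c - b) := by linarith
    have h := h₁.concat hab hbc h₃ (by simpa using h₂c.symm)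
    have hle := ccDist_le (hab.trans hbc) h
    have e₁ : (∫ t in a..b, speed (fun i t => if t ≤ b then u₁ i t else u₂ i (t + (c - b))) t) =
        ∫ t in a..b, speed u₁ t := by
      refine intervalIntegral.integral_congr_uIoo fun t ht => ?_
      rw [uIoo_of_le hab] at ht
      simp [speed, ht.2.le]
    have e₂ : (∫ t in b..(d - (c - b)),
        speed (fun i t => if t ≤ b then u₁ i t else u₂ i (t + (c - b))) t) =
        ∫ t in c..d, speed u₂ t := by
      have : (∫ t in b..(d - (c - b)), speed u₂ (t + (c - b))) = ∫ t in c..d, speed u₂ t := by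
        rw [intervalIntegral.integral_comp_add_right]
        congr 1 <;> ring
      rw [← this]
      refine intervalIntegral.integral_congr_uIoo fun t ht => ?_
      rw [uIoo_of_le hbc] at ht
      simp [speed, not_le.2 ht.1]
    have I := intervalIntegrable_speed h.integrable
    have I₁ := I.mono_set (c := a) (d := b) (by
      rw [uIcc_of_le hab, uIcc_of_le (hab.trans hbc)]; exact Icc_subset_Icc_right hbc)
    have I₂ := I.mono_set (c := b) (d := d - (c - b)) (by
      rw [uIcc_of_le hbc, uIcc_of_le (hab.trans hbc)]; exact Icc_subset_Icc_left hab)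
    rw [← intervalIntegral.integral_add_adjacent_intervals I₁ I₂, e₁, e₂,
      ENNReal.ofReal_add (intervalIntegral.integral_nonneg hab fun t _ => speed_nonneg _ _)
        (intervalIntegral.integral_nonneg hcd fun t _ => speed_nonneg _ _)] at hle
    refine le_trans (le_of_eq ?_) hle
    congr 1
    · simp [hab]
    · by_cases hd : d - (c - b) ≤ b
      · have : c = d := by linarith
        subst this
        simp [h₂c]
      · simp [hd]
  rw [ccDist.eq_1 X x y, ENNReal.sInf_add]
  exact le_iInf₂ key

/-- Left invariant fields are continuous. -/
theorem continuous_leftField [LieGroup 𝓘(ℝ, E) ∞ E] (v : GroupLieAlgebra 𝓘(ℝ, E) E) :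
    Continuous (leftField v) := by
  have : LieGroup 𝓘(ℝ, E) (minSmoothness ℝ 3) E := by
    rw [minSmoothness_of_isRCLikeNormedField]
    infer_instance
  refine continuous_iff_continuousAt.2 fun x => ?_
  have h := contMDiffAt_mulInvariantVectorField (I := 𝓘(ℝ, E)) v (g := x)
  exact (contMDiffAt_vectorSpace_iff_contDiffAt.1 h).continuousAt

/-- A family of left invariant fields is bounded near a point, uniformly in the controls. -/
theorem exists_bound [LieGroup 𝓘(ℝ, E) ∞ E] [FiniteDimensional ℝ E]
    (X : ι → GroupLieAlgebra 𝓘(ℝ, E) E) (x : E) (r : ℝ) :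
    ∃ C > 0, ∀ z ∈ Metric.closedBall x r, ∀ (u : ι → ℝ → ℝ) (t : ℝ),
      ‖∑ i, u i t • leftField (X i) z‖ ≤ C * speed u t := by
  have := FiniteDimensional.proper_real E
  have hc : ContinuousOn (fun z => ∑ i, ‖leftField (X i) z‖) (Metric.closedBall x r) :=
    (continuous_finsetSum _ fun i _ => (continuous_leftField (X i)).norm).continuousOn
  obtain ⟨C, hC⟩ := (isCompact_closedBall x r).exists_bound_of_continuousOn hc
  refine ⟨max C 1, by positivity, fun z hz u t => ?_⟩
  calc ‖∑ i, u i t • leftField (X i) z‖ ≤ ∑ i, ‖u i t • leftField (X i) z‖ := norm_sum_le _ _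
    _ ≤ ∑ i, speed u t * ‖leftField (X i) z‖ := by
        refine Finset.sum_le_sum fun i _ => ?_
        rw [norm_smul]
        exact mul_le_mul_of_nonneg_right (abs_le_speed u t i) (norm_nonneg _)
    _ = (∑ i, ‖leftField (X i) z‖) * speed u t := by rw [← Finset.mul_sum, mul_comm]
    _ ≤ max C 1 * speed u t := by
        refine mul_le_mul_of_nonneg_right ?_ (speed_nonneg _ _)
        exact (le_abs_self _).trans ((hC z hz).trans (le_max_left _ _))

/-- A horizontal curve that stays in a ball moves at most a constant times its length. -/
theorem IsHorizontalWith.norm_sub_le {X : ι → GroupLieAlgebra 𝓘(ℝ, E) E} {γ : ℝ → E} {a b C : ℝ}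
    {u : ι → ℝ → ℝ} (hab : a ≤ b) (h : IsHorizontalWith X γ a b u)
    (hC : ∀ t ∈ Ioo a b, ‖∑ i, u i t • leftField (X i) (γ t)‖ ≤ C * speed u t) :
    ‖γ b - γ a‖ ≤ C * ∫ t in a..b, speed u t := by
  obtain ⟨φ, hφ, hφv⟩ := exists_dual_vector'' ℝ (γ b - γ a)
  have hac : AbsolutelyContinuousOnInterval (fun t => φ (γ t)) a b := by
    have := h.absCont
    rw [absolutelyContinuousOnInterval_iff] at this ⊢
    intro ε hε
    obtain ⟨δ, hδ, H⟩ := this ε hε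
    refine ⟨δ, hδ, fun I hI hs => (Finset.sum_le_sum fun i _ => ?_).trans_lt (H I hI hs)⟩
    rw [dist_eq_norm, dist_eq_norm, ← map_sub]
    exact (φ.le_opNorm _).trans (mul_le_of_le_one_left (norm_nonneg _) hφ)
  have hint := hac.integral_deriv_eq_sub
  have e : ‖γ b - γ a‖ = ∫ t in a..b, deriv (fun t => φ (γ t)) t := by
    rw [hint, ← map_sub, hφv]
    rfl
  rw [e, ← intervalIntegral.integral_const_mul]
  refine intervalIntegral.integral_mono_ae_restrict hab hac.intervalIntegrable_deriv
    ((intervalIntegrable_speed h.integrable).const_mul C) ?_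
  have hne : ∀ᵐ t : ℝ ∂volume, t ≠ a ∧ t ≠ b := by
    have h1 : ∀ᵐ t : ℝ ∂volume, t ≠ a := by simp [ae_iff]
    have h2 : ∀ᵐ t : ℝ ∂volume, t ≠ b := by simp [ae_iff]
    exact h1.and h2
  refine (ae_restrict_iff' measurableSet_Icc).2 ?_
  filter_upwards [h.hasDerivAt, hne] with t ht hne hmem
  have hd := ht (by rwa [uIcc_of_le hab])
  have hd' : HasDerivAt (fun t => φ (γ t)) (φ (∑ i, u i t • leftField (X i) (γ t))) t :=
    φ.hasFDerivAt.comp_hasDerivAt t hd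
  rw [hd'.deriv]
  refine (le_abs_self _).trans ?_
  refine (φ.le_opNorm _).trans ((mul_le_of_le_one_left (norm_nonneg _) hφ).trans ?_)
  exact hC t ⟨lt_of_le_of_ne hmem.1 (Ne.symm hne.1), lt_of_le_of_ne hmem.2 hne.2⟩

theorem IsHorizontalWith.mono {X : ι → GroupLieAlgebra 𝓘(ℝ, E) E} {γ : ℝ → E} {a b c d : ℝ}
    {u : ι → ℝ → ℝ} (h : IsHorizontalWith X γ a b u) (hs : uIcc c d ⊆ uIcc a b) :
    IsHorizontalWith X γ c d u where
  absCont := h.absCont.mono hs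
  integrable i := (h.integrable i).mono_set hs
  hasDerivAt := by
    filter_upwards [h.hasDerivAt] with t ht hmem using ht (hs hmem)

theorem eq_of_ccDist_eq_zero [LieGroup 𝓘(ℝ, E) ∞ E] [FiniteDimensional ℝ E]
    (X : ι → GroupLieAlgebra 𝓘(ℝ, E) E) {x y : E} (h : ccDist X x y = 0) : x = y := by
  by_contra hne
  set r := ‖y - x‖ with hr
  have hr0 : 0 < r := norm_pos_iff.2 (sub_ne_zero.2 (Ne.symm hne))
  obtain ⟨C, hC0, hC⟩ := exists_bound X x r
  have hlt : ccDist X x y < ENNReal.ofReal (r / C) := by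
    rw [h]
    exact ENNReal.ofReal_pos.2 (div_pos hr0 hC0)
  obtain ⟨l, ⟨a, b, γ, u, hab, hγ, ha, hb, rfl⟩, hl⟩ := sInf_lt_iff.1 hlt
  have hl' := (ENNReal.ofReal_lt_ofReal_iff (div_pos hr0 hC0)).1 hl
  -- the first time at which the curve leaves the open ball
  set S := {t ∈ Icc a b | r ≤ ‖γ t - x‖} with hS
  have hcont : ContinuousOn γ (Icc a b) := by
    have := hγ.absCont.continuousOn
    rwa [uIcc_of_le hab] at this
  have hSc : IsClosed S :=
    ((hcont.sub continuousOn_const).norm).preimage_isClosed_of_isClosed isClosed_Icc isClosed_Ici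
  have hSne : S.Nonempty := ⟨b, ⟨hab, le_rfl⟩, by rw [hb]⟩
  have hSb : BddBelow S := ⟨a, fun t ht => ht.1.1⟩
  have ht₀ := hSc.csInf_mem hSne hSb
  set t₀ := sInf S
  have hsub : uIcc a t₀ ⊆ uIcc a b := by
    rw [uIcc_of_le ht₀.1.1, uIcc_of_le hab]
    exact Icc_subset_Icc_right ht₀.1.2
  have hle := (hγ.mono hsub).norm_sub_le (C := C) ht₀.1.1 fun t ht => by
    refine hC _ ?_ u t
    rw [mem_closedBall_iff_norm]
    by_contra hcon
    exact absurd (csInf_le hSb ⟨⟨ht.1.le, ht.2.le.trans ht₀.1.2⟩, (not_le.1 hcon).le⟩)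
      (not_le.2 ht.2)
  rw [ha] at hle
  have hmono : (∫ t in a..t₀, speed u t) ≤ ∫ t in a..b, speed u t :=
    intervalIntegral.integral_mono_interval le_rfl ht₀.1.1 ht₀.1.2
      (Filter.Eventually.of_forall fun t => speed_nonneg u t)
      (intervalIntegrable_speed hγ.integrable)
  have h1 : r ≤ C * ∫ t in a..b, speed u t :=
    ht₀.2.trans (hle.trans (mul_le_mul_of_nonneg_left hmono hC0.le))
  rw [lt_div_iff₀ hC0] at hl'
  linarith

/-! ### The group as a metric space -/

/-- The vector space `E` with the Carnot-Carathéodory metric of the family `X`. -/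
def CCSpace (_X : ι → GroupLieAlgebra 𝓘(ℝ, E) E) : Type _ := E

/-- The identity map from `E` to `E` with the Carnot-Carathéodory metric. -/
def toCC (X : ι → GroupLieAlgebra 𝓘(ℝ, E) E) : E ≃ CCSpace X := Equiv.refl E

instance [LieGroup 𝓘(ℝ, E) ∞ E] [FiniteDimensional ℝ E] (X : ι → GroupLieAlgebra 𝓘(ℝ, E) E) :
    EMetricSpace (CCSpace X) where
  edist p q := ccDist X ((toCC X).symm p) ((toCC X).symm q)
  edist_self p := ccDist_self X _
  edist_comm p q := ccDist_comm X _ _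
  edist_triangle p q r := ccDist_triangle X _ _ _
  eq_of_edist_eq_zero h := (toCC X).symm.injective (eq_of_ccDist_eq_zero X h)

instance [LieGroup 𝓘(ℝ, E) ∞ E] [FiniteDimensional ℝ E] (X : ι → GroupLieAlgebra 𝓘(ℝ, E) E) :
    MeasurableSpace (CCSpace X) := borel _

instance [LieGroup 𝓘(ℝ, E) ∞ E] [FiniteDimensional ℝ E] (X : ι → GroupLieAlgebra 𝓘(ℝ, E) E) :
    BorelSpace (CCSpace X) := ⟨rfl⟩

/-- `S` is purely `C¹_H` 1-unrectifiable: it meets the image of every `C¹_H` curve on `[0, 1]` in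
a set of zero 1-dimensional Hausdorff measure for the Carnot-Carathéodory metric. -/
def IsPurelyC1HUnrectifiable [LieGroup 𝓘(ℝ, E) ∞ E] [FiniteDimensional ℝ E]
    (X : ι → GroupLieAlgebra 𝓘(ℝ, E) E) (S : Set E) : Prop :=
  ∀ Γ : ℝ → E, IsC1H X Γ 0 1 →
    Measure.hausdorffMeasure 1 (toCC X '' (S ∩ Γ '' Icc 0 1)) = 0

/-- `γ` is Lipschitz on `[0, 1]`, for some constant, for the Carnot-Carathéodory metric. -/
def IsLipschitzCurve [LieGroup 𝓘(ℝ, E) ∞ E] [FiniteDimensional ℝ E]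
    (X : ι → GroupLieAlgebra 𝓘(ℝ, E) E) (γ : ℝ → E) : Prop :=
  ∃ K : ℝ≥0, LipschitzOnWith K (fun t => toCC X (γ t)) (Icc 0 1)

end Basic

end Carnot

end

/-!
Suppose that a `C¹_H` curve `Γ` meets the image of `γ` in a set of positive measure `ℋ¹`. The
critical values of `Γ` are `ℋ¹`-null (`IsC1H.hausdorffMeasure_critical`), so `γ` also meets a short
regular arc of `Γ` in a set of positive measure. On such an arc `Γ` is bi-Lipschitz for the norm,
and `γ` is Lipschitz for the norm (`exists_lipschitzOnWith_norm`). Hence `γ = Γ ∘ σ` with `σ`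
Lipschitz on the set `A` of times at which `γ` is on the arc, and `A` has positive measure because
`γ` does not increase `ℋ¹` by more than a constant factor. By Whitney's extension theorem on the
line, `σ` agrees with a `C¹` function `g` on a subset of `A` of positive measure
(`exists_contDiff_volume_eq_ne_zero`). The curve `Γ ∘ g`, with `g` truncated smoothly so as to stay
in `[0, 1]`, is `C¹_H` (`IsC1H.comp`) and agrees with `γ` on a set of positive measure, against the
hypothesis.

The last step uses that a `C¹_H` curve solves its control equation at every time, with continuous
controls (`IsC1H.exists_continuousOn_controls`); otherwise the controls of a reparametrised curve
would be defined only up to the preimage of a null set.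
-/

namespace Carnot

/-! ### `C¹` functions that agree with a Lipschitz function on a set of positive measure -/

/-- Whitney's extension theorem on the line, for zero prescribed derivative: a Lipschitz function
on a closed set `K` that is uniformly `o(|s - t|)` on `K` agrees on `K` with a `C¹` function.
The set `K` is assumed to be unbounded on both sides, so that its complement consists of bounded
gaps; on each gap the extension is a cubic with zero derivative at both ends. -/
theorem exists_contDiff_eqOn_of_isLittleO {K : Set ℝ} (hK : IsClosed K)
    (hl : ∀ t, ∃ a ∈ K, a ≤ t) (hu : ∀ t, ∃ b ∈ K, t ≤ b) {f : ℝ → ℝ} {L : ℝ}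
    (hL : ∀ s ∈ K, ∀ t ∈ K, |f s - f t| ≤ L * |s - t|)
    (hf : ∀ ε > 0, ∃ δ > 0, ∀ s ∈ K, ∀ t ∈ K, |s - t| < δ → |f s - f t| ≤ ε * |s - t|) :
    ∃ g : ℝ → ℝ, ContDiff ℝ 1 g ∧ EqOn g f K := by
  -- the last point `a t` of `K` before `t`, and the first point `b t` of `K` after `t`
  have ha : ∀ t, ∃ a ∈ K, a ≤ t ∧ ∀ x ∈ K, x ≤ t → x ≤ a := fun t => by
    obtain ⟨a, haK, hat⟩ := hl t
    have hb : BddAbove (K ∩ Iic t) := ⟨t, fun x hx => hx.2⟩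
    have hm := (hK.inter isClosed_Iic).csSup_mem ⟨a, haK, hat⟩ hb
    exact ⟨_, hm.1, hm.2, fun x hx hxt => le_csSup hb ⟨hx, hxt⟩⟩
  have hb : ∀ t, ∃ b ∈ K, t ≤ b ∧ ∀ x ∈ K, t ≤ x → b ≤ x := fun t => by
    obtain ⟨a, haK, hat⟩ := hu t
    have hb : BddBelow (K ∩ Ici t) := ⟨t, fun x hx => hx.2⟩
    have hm := (hK.inter isClosed_Ici).csInf_mem ⟨a, haK, hat⟩ hb
    exact ⟨_, hm.1, hm.2, fun x hx hxt => csInf_le hb ⟨hx, hxt⟩⟩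
  choose a haK hat hamax using ha
  choose b hbK htb hbmin using hb
  have haeq : ∀ t ∈ K, a t = t := fun t ht => le_antisymm (hat t) (hamax t t ht le_rfl)
  have hbeq : ∀ t ∈ K, b t = t := fun t ht => le_antisymm (hbmin t t ht le_rfl) (htb t)
  have hgap : ∀ t ∉ K, a t < t ∧ t < b t := fun t ht =>
    ⟨(hat t).lt_of_ne fun h => ht (h ▸ haK t), (htb t).lt_of_ne fun h => ht (h.symm ▸ hbK t)⟩
  have hconst : ∀ t ∉ K, ∀ s ∈ Ioo (a t) (b t), a s = a t ∧ b s = b t := by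
    intro t ht s hs
    have h1 : a s ≤ a t := by
      by_contra! hcon
      rcases le_total (a s) t with h | h
      · exact absurd (hamax t _ (haK s) h) (not_le.2 hcon)
      · exact absurd (hbmin t _ (haK s) h) (not_le.2 ((hat s).trans_lt hs.2))
    have h2 : b t ≤ b s := by
      by_contra! hcon
      rcases le_total (b s) t with h | h
      · exact absurd (hamax t _ (hbK s) h) (not_le.2 (hs.1.trans_le (htb s)))
      · exact absurd (hbmin t _ (hbK s) h) (not_le.2 hcon)
    exact ⟨le_antisymm h1 (hamax s _ (haK t) hs.1.le), le_antisymm (hbmin s _ (hbK t) hs.2.le) h2⟩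
  -- on a gap: the slope `q`, the relative position `x`, the interpolation `g`, its derivative `k`
  set q : ℝ → ℝ := fun s => (f (b s) - f (a s)) / (b s - a s) with hq
  set x : ℝ → ℝ := fun s => (s - a s) / (b s - a s) with hx
  set g : ℝ → ℝ := fun s => f (a s) + (f (b s) - f (a s)) * (3 * x s ^ 2 - 2 * x s ^ 3) with hg
  set k : ℝ → ℝ := fun s => q s * (6 * x s * (1 - x s)) with hk
  have hgK : EqOn g f K := fun t ht => by simp [hg, haeq t ht, hbeq t ht]
  have hkK : ∀ t ∈ K, k t = 0 := fun t ht => by simp [hk, hq, haeq t ht, hbeq t ht]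
  have hx0 : ∀ s, 0 ≤ x s := fun s =>
    div_nonneg (sub_nonneg.2 (hat s)) (sub_nonneg.2 ((hat s).trans (htb s)))
  have hx1 : ∀ s, x s ≤ 1 := fun s =>
    div_le_one_of_le₀ (by linarith [htb s]) (sub_nonneg.2 ((hat s).trans (htb s)))
  -- the steep gaps are long, and a long gap is met near `K` only close to one of its ends
  have key : ∀ t ∈ K, ∀ ε > 0, ∃ δ > 0, ∀ s, |s - t| < δ →
      (t ≤ s → |q s| * x s ≤ ε) ∧ (s ≤ t → |q s| * (1 - x s) ≤ ε) := by
    intro t ht ε hε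
    obtain ⟨δ, hδ, H⟩ := hf ε hε
    have hL' : 0 < |L| + 1 := by positivity
    refine ⟨δ * (ε / (|L| + 1)), by positivity, fun s hs => ?_⟩
    rcases ((hat s).trans (htb s)).eq_or_lt with hab | hab
    · simp [hq, hab, hε.le]
    have hba : 0 < b s - a s := sub_pos.2 hab
    rcases lt_or_ge (b s - a s) δ with hlt | hge
    · have h1 : |q s| ≤ ε := by
        rw [hq, abs_div]
        refine div_le_of_le_mul₀ (abs_nonneg _) hε.le (H _ (hbK s) _ (haK s) ?_)
        rwa [abs_of_pos hba]
      have h2 := abs_nonneg (q s)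
      constructor <;> intro _ <;> nlinarith [hx0 s, hx1 s]
    · have h1 : |q s| ≤ |L| + 1 := by
        rw [hq, abs_div]
        refine div_le_of_le_mul₀ (abs_nonneg _) hL'.le ((hL _ (hbK s) _ (haK s)).trans ?_)
        exact mul_le_mul_of_nonneg_right (by linarith [le_abs_self L]) (abs_nonneg _)
      have hpos : ∀ y, 0 ≤ y → y ≤ |s - t| → |q s| * (y / (b s - a s)) ≤ ε := by
        intro y hy0 hy
        have h2 : y / (b s - a s) ≤ ε / (|L| + 1) := by
          rw [div_le_iff₀ hba]
          nlinarith [div_pos hε hL', hs.le]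
        calc |q s| * (y / (b s - a s)) ≤ (|L| + 1) * (ε / (|L| + 1)) :=
              mul_le_mul h1 h2 (by positivity) hL'.le
          _ = ε := by field_simp
      refine ⟨fun hts => hpos _ (sub_nonneg.2 (hat s)) ?_, fun hst => ?_⟩
      · rw [abs_of_nonneg (sub_nonneg.2 hts)]
        linarith [hamax s t ht hts]
      · have e : 1 - x s = (b s - s) / (b s - a s) := by
          simp only [hx]
          field_simp
          ring
        rw [e]
        refine hpos _ (sub_nonneg.2 (htb s)) ?_
        rw [abs_of_nonpos (sub_nonpos.2 hst)]
        linarith [hbmin s t ht hst]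
  have hloc : ∀ t ∉ K, ∀ᶠ s in nhds t, a s = a t ∧ b s = b t := fun t ht => by
    filter_upwards [Ioo_mem_nhds (hgap t ht).1 (hgap t ht).2] with s hs using hconst t ht s hs
  have hderiv : ∀ t, HasDerivAt g (k t) t := by
    intro t
    by_cases ht : t ∈ K
    · rw [hkK t ht, hasDerivAt_iff_isLittleO, Asymptotics.isLittleO_iff]
      intro c hc
      obtain ⟨δ₁, hδ₁, H₁⟩ := hf (c / 4) (by positivity)
      obtain ⟨δ₂, hδ₂, H₂⟩ := key t ht (c / 4) (by positivity)
      filter_upwards [Metric.ball_mem_nhds t (lt_min hδ₁ hδ₂)] with s hs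
      rw [Metric.mem_ball, Real.dist_eq, lt_min_iff] at hs
      rw [smul_zero, sub_zero, hgK ht, Real.norm_eq_abs, Real.norm_eq_abs]
      have hqf : f (b s) - f (a s) = q s * (b s - a s) := by
        rcases ((hat s).trans (htb s)).eq_or_lt with hab | hab
        · simp [hab]
        · simp only [hq]
          field_simp [(sub_pos.2 hab).ne']
      have hxs : x s * (b s - a s) = s - a s := by
        rcases ((hat s).trans (htb s)).eq_or_lt with hab | hab
        · have := hat s
          have := htb s
          simp only [hab, sub_self, mul_zero]
          linarith
        · simp only [hx]
          field_simp [(sub_pos.2 hab).ne']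
      have hx0 := hx0 s
      have hx1 := hx1 s
      rcases le_total t s with hts | hst
      · have h1 := (H₂ s hs.2).1 hts
        have hta := hamax s t ht hts
        have h2 : |f (a s) - f t| ≤ c / 4 * |a s - t| := by
          refine H₁ _ (haK s) _ ht (lt_of_le_of_lt ?_ hs.1)
          rw [abs_of_nonneg (sub_nonneg.2 hta), abs_of_nonneg (sub_nonneg.2 hts)]
          linarith [hat s]
        have e : g s - f t = (f (a s) - f t) + (q s * x s) * ((s - a s) * (3 - 2 * x s)) := by
          simp only [hg]
          rw [hqf, ← hxs]
          ring
        rw [e]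
        refine (abs_add_le _ _).trans ?_
        rw [abs_mul (q s * x s), abs_mul (q s), abs_of_nonneg hx0,
          abs_of_nonneg (mul_nonneg (sub_nonneg.2 (hat s)) (by linarith : 0 ≤ 3 - 2 * x s))]
        rw [abs_of_nonneg (sub_nonneg.2 hta)] at h2
        rw [abs_of_nonneg (sub_nonneg.2 hts)]
        have h3 : (s - a s) * (3 - 2 * x s) ≤ (s - a s) * 3 :=
          mul_le_mul_of_nonneg_left (by linarith) (sub_nonneg.2 (hat s))
        have h4 := mul_le_mul h1 h3
          (mul_nonneg (sub_nonneg.2 (hat s)) (by linarith)) (by positivity)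
        nlinarith
      · have h1 := (H₂ s hs.2).2 hst
        have hta := hbmin s t ht hst
        have h2 : |f (b s) - f t| ≤ c / 4 * |b s - t| := by
          refine H₁ _ (hbK s) _ ht (lt_of_le_of_lt ?_ hs.1)
          rw [abs_of_nonpos (sub_nonpos.2 hta), abs_of_nonpos (sub_nonpos.2 hst)]
          linarith [htb s]
        have hbs : (1 - x s) * (b s - a s) = b s - s := by linear_combination -hxs
        have e : g s - f t = (f (b s) - f t) -
            (q s * (1 - x s)) * ((b s - s) * (1 + 2 * x s)) := by
          simp only [hg]
          rw [← hbs]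
          linear_combination (3 * x s ^ 2 - 2 * x s ^ 3 - 1) * hqf
        rw [e]
        refine (abs_sub _ _).trans ?_
        rw [abs_mul (q s * (1 - x s)), abs_mul (q s), abs_of_nonneg (sub_nonneg.2 hx1),
          abs_of_nonneg (mul_nonneg (sub_nonneg.2 (htb s)) (by linarith : 0 ≤ 1 + 2 * x s))]
        rw [abs_of_nonpos (sub_nonpos.2 hta)] at h2
        rw [abs_of_nonpos (sub_nonpos.2 hst)]
        have h3 : (b s - s) * (1 + 2 * x s) ≤ (b s - s) * 3 :=
          mul_le_mul_of_nonneg_left (by linarith) (sub_nonneg.2 (htb s))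
        have h4 := mul_le_mul h1 h3
          (mul_nonneg (sub_nonneg.2 (htb s)) (by linarith)) (by positivity)
        nlinarith
    · have hba : b t - a t ≠ 0 := by linarith [(hgap t ht).1, (hgap t ht).2]
      have e : g =ᶠ[nhds t] fun s => f (a t) + (f (b t) - f (a t)) *
          (3 * ((s - a t) / (b t - a t)) ^ 2 - 2 * ((s - a t) / (b t - a t)) ^ 3) := by
        filter_upwards [hloc t ht] with s hs
        simp only [hg, hx, hs.1, hs.2]
      refine HasDerivAt.congr_of_eventuallyEq ?_ e
      have hX : HasDerivAt (fun s => (s - a t) / (b t - a t)) (1 / (b t - a t)) t :=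
        ((hasDerivAt_id t).sub_const _).div_const _
      convert! ((((hX.pow 2).const_mul 3).sub ((hX.pow 3).const_mul 2)).const_mul
        (f (b t) - f (a t))).const_add (f (a t)) using 1
      simp only [hk, hq, hx]
      push_cast
      ring
  have hcont : Continuous k := by
    refine continuous_iff_continuousAt.2 fun t => ?_
    by_cases ht : t ∈ K
    · rw [Metric.continuousAt_iff]
      intro ε hε
      obtain ⟨δ, hδ, H⟩ := key t ht (ε / 7) (by positivity)
      refine ⟨δ, hδ, fun s hs => ?_⟩
      rw [hkK t ht, Real.dist_eq, sub_zero]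
      have h := H s (by rwa [Real.dist_eq] at hs)
      have hx0 := hx0 s
      have hx1 := hx1 s
      have hq0 := abs_nonneg (q s)
      simp only [hk]
      rw [abs_mul, abs_of_nonneg (by nlinarith : 0 ≤ 6 * x s * (1 - x s))]
      rcases le_total t s with hts | hst
      · have h1 := h.1 hts
        have : |q s| * (6 * x s * (1 - x s)) ≤ 6 * (|q s| * x s) := by
          nlinarith [mul_nonneg hq0 (mul_nonneg hx0 hx0)]
        linarith
      · have h1 := h.2 hst
        have : |q s| * (6 * x s * (1 - x s)) ≤ 6 * (|q s| * (1 - x s)) := by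
          nlinarith [mul_nonneg hq0 (mul_nonneg (sub_nonneg.2 hx1) (sub_nonneg.2 hx1))]
        linarith
    · have e : k =ᶠ[nhds t] fun s => (f (b t) - f (a t)) / (b t - a t) *
          (6 * ((s - a t) / (b t - a t)) * (1 - (s - a t) / (b t - a t))) := by
        filter_upwards [hloc t ht] with s hs
        simp only [hk, hq, hx, hs.1, hs.2]
      refine ContinuousAt.congr ?_ e.symm
      fun_prop
  refine ⟨g, contDiff_one_iff_deriv.2 ⟨fun t => (hderiv t).differentiableAt, ?_⟩, hgK⟩
  rwa [show deriv g = k from funext fun t => (hderiv t).deriv]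

/-- Whitney's extension theorem for `C¹` functions on the line: a Lipschitz function on a compact
set `K` that is differentiable along `K`, uniformly, agrees on `K` with a `C¹` function. -/
theorem exists_contDiff_eqOn_of_uniform_deriv {K : Set ℝ} (hK : IsCompact K) {f D : ℝ → ℝ} {L : ℝ}
    (hL : ∀ s ∈ K, ∀ t ∈ K, |f s - f t| ≤ L * |s - t|)
    (hf : ∀ ε > 0, ∃ δ > 0, ∀ s ∈ K, ∀ t ∈ K, |s - t| < δ →
      |f s - f t - D t * (s - t)| ≤ ε * |s - t|) :
    ∃ g : ℝ → ℝ, ContDiff ℝ 1 g ∧ EqOn g f K := by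
  rcases K.eq_empty_or_nonempty with rfl | hne
  · exact ⟨0, contDiff_const, eqOn_empty _ _⟩
  -- exchanging the roles of `s` and `t` shows that the derivative is continuous along `K`
  have hD : ContinuousOn D K := by
    intro t ht
    rw [Metric.continuousWithinAt_iff]
    intro ε hε
    obtain ⟨δ, hδ, H⟩ := hf (ε / 3) (by positivity)
    refine ⟨δ, hδ, fun s hs hst => ?_⟩
    rcases eq_or_ne s t with rfl | hne
    · simpa using hε
    rw [Real.dist_eq] at hst ⊢
    have h1 := H s hs t ht hst
    have h2 := H t ht s hs (by rwa [abs_sub_comm])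
    rw [abs_sub_comm t s] at h2
    have hpos : 0 < |s - t| := abs_pos.2 (sub_ne_zero.2 hne)
    have h3 : |D s - D t| * |s - t| ≤ 2 * (ε / 3) * |s - t| := by
      rw [← abs_mul]
      have e : (D s - D t) * (s - t) = (f s - f t - D t * (s - t)) +
        (f t - f s - D s * (t - s)) := by ring
      rw [e]
      exact (abs_add_le _ _).trans (by linarith)
    have := le_of_mul_le_mul_right h3 hpos
    linarith
  obtain ⟨h, hh⟩ := ContinuousMap.exists_restrict_eq hK.isClosed
    (⟨K.domRestrict D, hD.domRestrict⟩ : C(K, ℝ))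
  have hhD : ∀ t ∈ K, h t = D t := fun t ht => 
    DFunLike.congr_fun hh (⟨t, ht⟩ : K)
  -- subtracting a primitive of `h` reduces to the case of zero derivative
  set G : ℝ → ℝ := fun t => ∫ r in (0 : ℝ)..t, h r with hG
  have hGd : ∀ t, HasDerivAt G (h t) t := fun t =>
    intervalIntegral.integral_hasDerivAt_right (h.continuous.intervalIntegrable _ _)
      h.continuous.stronglyMeasurable.stronglyMeasurableAtFilter h.continuous.continuousAt
  have hGc : ContDiff ℝ 1 G := contDiff_one_iff_deriv.2
    ⟨fun t => (hGd t).differentiableAt, by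
      rw [show deriv G = h from funext fun t => (hGd t).deriv]; exact h.continuous⟩
  have hGs : ∀ s t, G s - G t = ∫ r in t..s, h r := fun s t =>
    intervalIntegral.integral_interval_sub_left (h.continuous.intervalIntegrable _ _)
      (h.continuous.intervalIntegrable _ _)
  set m := sInf K with hm
  set M := sSup K with hM
  have hmK : m ∈ K := hK.sInf_mem hne
  have hMK : M ∈ K := hK.sSup_mem hne
  have hKI : K ⊆ Icc m M := fun t ht => ⟨csInf_le hK.bddBelow ht, le_csSup hK.bddAbove ht⟩
  have hmM : m ≤ M := (hKI hmK).2
  obtain ⟨B, hB⟩ := isCompact_Icc.exists_bound_of_continuousOn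
    (h.continuous.continuousOn (s := Icc m M))
  have hsub : ∀ s ∈ K, ∀ t ∈ K, uIoc t s ⊆ Icc m M := fun s hs t ht =>
    uIoc_subset_uIcc.trans (uIcc_subset_Icc (hKI ht) (hKI hs))
  set e : ℝ → ℝ := fun t => f t - G t with he
  have heL : ∀ s ∈ K, ∀ t ∈ K, |e s - e t| ≤ (L + B) * |s - t| := by
    intro s hs t ht
    have h1 : |G s - G t| ≤ B * |s - t| := by
      rw [hGs, ← Real.norm_eq_abs]
      exact intervalIntegral.norm_integral_le_of_norm_le_const fun r hr => hB r (hsub s hs t ht hr)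
    have h2 := hL s hs t ht
    have e1 : e s - e t = (f s - f t) - (G s - G t) := by simp only [he]; ring
    rw [e1, add_mul]
    exact (abs_sub _ _).trans (add_le_add h2 h1)
  have heS : ∀ ε > 0, ∃ δ > 0, ∀ s ∈ K, ∀ t ∈ K, |s - t| < δ → |e s - e t| ≤ ε * |s - t| := by
    intro ε hε
    obtain ⟨δ₁, hδ₁, H₁⟩ := hf (ε / 2) (by positivity)
    obtain ⟨δ₂, hδ₂, H₂⟩ := Metric.uniformContinuousOn_iff.1
      (isCompact_Icc.uniformContinuousOn_of_continuous
        (h.continuous.continuousOn (s := Icc m M))) (ε / 2) (by positivity)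
    refine ⟨min δ₁ δ₂, lt_min hδ₁ hδ₂, fun s hs t ht hst => ?_⟩
    rw [lt_min_iff] at hst
    have h1 := H₁ s hs t ht hst.1
    have h2 : |G s - G t - h t * (s - t)| ≤ ε / 2 * |s - t| := by
      have e2 : G s - G t - h t * (s - t) = ∫ r in t..s, (h r - h t) := by
        rw [intervalIntegral.integral_sub (h.continuous.intervalIntegrable _ _) (by simp), hGs]
        simp [mul_comm]
      rw [e2, ← Real.norm_eq_abs]
      refine intervalIntegral.norm_integral_le_of_norm_le_const fun r hr => ?_
      refine (H₂ r (hsub s hs t ht hr) t (hKI ht) (lt_of_le_of_lt ?_ hst.2)).le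
      exact Set.abs_sub_left_of_mem_uIcc (uIoc_subset_uIcc hr)
    rw [hhD t ht] at h2
    have e1 : e s - e t = (f s - f t - D t * (s - t)) - (G s - G t - D t * (s - t)) := by
      simp only [he]; ring
    rw [e1]
    exact (abs_sub _ _).trans (by linarith)
  -- `K` is completed by two half lines, on which the function is made constant
  set c : ℝ → ℝ := fun t => max m (min M t) with hc
  have hcK : ∀ t ∈ K, c t = t := fun t ht => by
    simp [hc, (hKI ht).1, (hKI ht).2]
  have hcm : ∀ t ≤ m, c t = m := fun t ht => by
    simp only [hc]
    rw [min_eq_right (ht.trans hmM), max_eq_left ht]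
  have hcM : ∀ t, M ≤ t → c t = M := fun t ht => by
    simp only [hc]
    rw [min_eq_left ht, max_eq_right hmM]
  have hc1 : ∀ s t, |c s - c t| ≤ |s - t| := fun s t => by
    have h1 := abs_max_sub_max_le_max m (min M s) m (min M t)
    have h2 := abs_min_sub_min_le_max M s M t
    simp only [sub_self, abs_zero, abs_nonneg, sup_of_le_right] at h1 h2
    exact h1.trans h2
  have hcmem : ∀ t ∈ K ∪ (Iic m ∪ Ici M), c t ∈ K := by
    rintro t (ht | ht | ht)
    · rwa [hcK t ht]
    · rwa [hcm t ht]
    · rwa [hcM t ht]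
  have hLB : ∀ y : ℝ, (L + B) * |y| ≤ |L + B| * |y| := fun y =>
    mul_le_mul_of_nonneg_right (le_abs_self _) (abs_nonneg _)
  obtain ⟨g, hg, hgK⟩ := exists_contDiff_eqOn_of_isLittleO (K := K ∪ (Iic m ∪ Ici M))
    (f := e ∘ c) (L := |L + B|) (hK.isClosed.union (isClosed_Iic.union isClosed_Ici))
    (fun t => ⟨min t m, Or.inr (Or.inl (mem_Iic.2 (min_le_right _ _))), min_le_left _ _⟩)
    (fun t => ⟨max t M, Or.inr (Or.inr (mem_Ici.2 (le_max_right t M))), le_max_left _ _⟩)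
    (fun s hs t ht => (heL _ (hcmem s hs) _ (hcmem t ht)).trans
      ((hLB _).trans (mul_le_mul_of_nonneg_left (hc1 s t) (abs_nonneg _))))
    (fun ε hε => by
      obtain ⟨δ, hδ, H⟩ := heS ε hε
      exact ⟨δ, hδ, fun s hs t ht hst =>
        (H _ (hcmem s hs) _ (hcmem t ht) ((hc1 s t).trans_lt hst)).trans
          (mul_le_mul_of_nonneg_left (hc1 s t) hε.le)⟩)
  refine ⟨fun t => g t + G t, hg.add hGc, fun t ht => ?_⟩
  have := hgK (Or.inl ht)
  simp only [Function.comp, hcK t ht, he] at this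
  simp [this]

/-- A Lipschitz function on the line agrees with a `C¹` function on a subset of positive measure of
any given set of positive finite measure: it is uniformly differentiable along a large compact
subset, to which Whitney's extension theorem applies. -/
theorem exists_contDiff_volume_eq_ne_zero {σ : ℝ → ℝ} {C : ℝ≥0} (hσ : LipschitzWith C σ)
    {A : Set ℝ} (hA : MeasurableSet A) (hA0 : volume A ≠ 0) (hA1 : volume A ≠ ⊤) :
    ∃ g : ℝ → ℝ, ContDiff ℝ 1 g ∧ volume {t ∈ A | g t = σ t} ≠ 0 := by
  -- restricting to rational increments keeps these sets measurable
  set B : ℕ → ℕ → Set ℝ := fun j n => {t | ∀ r : ℚ, |(r : ℝ)| < 1 / (n + 1) →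
    |σ (t + r) - σ t - deriv σ t * r| ≤ 1 / (j + 1) * |(r : ℝ)|} with hB
  have hBm : ∀ j n, MeasurableSet (B j n) := by
    intro j n
    simp only [hB, ofPred_forall]
    refine MeasurableSet.iInter fun r => MeasurableSet.iInter fun _ => ?_
    have h1 : Measurable fun t => |σ (t + r) - σ t - deriv σ t * r| := by
      have := hσ.continuous.measurable
      have := measurable_deriv σ
      exact ((by fun_prop : Measurable fun t => σ (t + r) - σ t - deriv σ t * r)).abs
    exact measurableSet_le h1 measurable_const
  have hBanti : ∀ j, Antitone fun n => A \ B j n := by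
    intro j n n' hnn' t ht
    refine ⟨ht.1, fun hcon => ht.2 fun r hr => hcon r (hr.trans_le ?_)⟩
    exact one_div_le_one_div_of_le (by positivity) (by exact_mod_cast Nat.succ_le_succ hnn')
  have hBnull : ∀ j, volume (⋂ n, A \ B j n) = 0 := by
    intro j
    refine measure_mono_null ?_ (ae_iff.1 hσ.ae_differentiableAt_real)
    intro t ht hd
    have hd' := hd.hasDerivAt
    rw [hasDerivAt_iff_isLittleO_nhds_zero, Asymptotics.isLittleO_iff] at hd'
    obtain ⟨δ, hδ, H⟩ := Metric.eventually_nhds_iff.1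
      (hd' (show (0 : ℝ) < 1 / (j + 1) by positivity))
    obtain ⟨n, hn⟩ := exists_nat_one_div_lt hδ
    refine (mem_iInter.1 ht n).2 fun r hr => ?_
    have := H (y := (r : ℝ)) (by rw [Real.dist_eq, sub_zero]; exact hr.trans hn)
    rwa [smul_eq_mul, mul_comm (r : ℝ)] at this
  obtain ⟨η, hη0, hη⟩ := ENNReal.exists_pos_sum_of_countable' hA0 ℕ
  have hN : ∀ j, ∃ n, volume (A \ B j n) < η j := by
    intro j
    have := tendsto_measure_iInter_atTop (μ := volume)
      (fun n => (hA.diff (hBm j n)).nullMeasurableSet) (hBanti j)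
      ⟨0, ne_top_of_le_ne_top hA1 (measure_mono sdiff_subset)⟩
    rw [hBnull j] at this
    exact (this.eventually_lt_const (hη0 j)).exists
  choose N hN using hN
  have hA' : MeasurableSet (A ∩ ⋂ j, B j (N j)) :=
    hA.inter (MeasurableSet.iInter fun j => hBm j (N j))
  have hpos : 0 < volume (A ∩ ⋂ j, B j (N j)) := by
    rw [pos_iff_ne_zero]
    intro hcon
    have h1 : volume A ≤ volume (A ∩ ⋂ j, B j (N j)) + volume (⋃ j, A \ B j (N j)) := by
      refine (measure_mono fun t ht => ?_).trans (measure_union_le _ _)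
      by_cases h : ∀ j, t ∈ B j (N j)
      · exact Or.inl ⟨ht, mem_iInter.2 h⟩
      · obtain ⟨j, hj⟩ := not_forall.1 h
        exact Or.inr (mem_iUnion.2 ⟨j, ht, hj⟩)
    rw [hcon, zero_add] at h1
    exact absurd (h1.trans ((measure_iUnion_le _).trans
      (ENNReal.tsum_le_tsum fun j => (hN j).le))) (not_le.2 hη)
  obtain ⟨K, hKA, hK, hKpos⟩ := hA'.exists_lt_isCompact hpos
  obtain ⟨g, hg, hgK⟩ := exists_contDiff_eqOn_of_uniform_deriv hK (f := σ) (D := deriv σ) (L := C)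
    (fun s _ t _ => by simpa [Real.dist_eq] using hσ.dist_le_mul s t)
    (fun ε hε => by
      obtain ⟨j, hj⟩ := exists_nat_one_div_lt hε
      refine ⟨1 / (N j + 1), by positivity, fun s _ t ht hst => ?_⟩
      have hmem := mem_iInter.1 (hKA ht).2 j
      -- by continuity, rational increments may be replaced by real ones
      have hclosed : IsClosed {r : ℝ | |σ (t + r) - σ t - deriv σ t * r| ≤ 1 / (j + 1) * |r|} := by
        have := hσ.continuous
        exact isClosed_le (by fun_prop) (by fun_prop)
      have hcl : s - t ∈ closure (Metric.ball (0 : ℝ) (1 / (N j + 1)) ∩ range ((↑) : ℚ → ℝ)) :=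
        Rat.isDenseEmbedding_coe_real.dense.open_subset_closure_inter Metric.isOpen_ball
          (by simpa [Real.dist_eq] using hst)
      have h := closure_minimal (t := {r : ℝ | |σ (t + r) - σ t - deriv σ t * r| ≤
          1 / (j + 1) * |r|}) (fun r hr => by
        obtain ⟨hr, r', rfl⟩ := hr
        exact hmem r' (by rwa [Metric.mem_ball, Real.dist_eq, sub_zero] at hr)) hclosed hcl
      simp only [mem_ofPred_eq, add_sub_cancel] at h
      exact h.trans (mul_le_mul_of_nonneg_right hj.le (abs_nonneg _)))
  refine ⟨g, hg, fun hcon => hKpos.ne' (measure_mono_null (fun t ht => ?_) hcon)⟩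
  exact ⟨(hKA ht).1, hgK ht⟩

section

variable {E : Type*} [NormedAddCommGroup E] [NormedSpace ℝ E] [Group E]
  {ι : Type*}

/-! ### Continuous controls -/

theorem differentiable_mul_left [LieGroup 𝓘(ℝ, E) ∞ E] (x : E) :
    Differentiable ℝ fun y : E => x * y := by
  have h : ContMDiff 𝓘(ℝ, E) 𝓘(ℝ, E) ∞ fun y : E => x * y := contMDiff_mul_left
  exact (contMDiff_iff_contDiff.1 h).differentiable (by simp)

/-- Left translations are diffeomorphisms, so their differentials at the identity are injective. -/
theorem fderiv_mul_left_injective [LieGroup 𝓘(ℝ, E) ∞ E] (x : E) :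
    Function.Injective (fderiv ℝ (fun y : E => x * y) 1) := by
  have h : (fun y : E => x⁻¹ * y) ∘ (fun y : E => x * y) = id := by
    funext y
    simp
  have h1 := fderiv_comp (1 : E) (differentiable_mul_left x⁻¹ (x * 1))
    (differentiable_mul_left x 1)
  rw [h, fderiv_id] at h1
  intro v w hvw
  have h2 := fun v => DFunLike.congr_fun h1 v
  simp only [ContinuousLinearMap.id_apply, ContinuousLinearMap.comp_apply] at h2
  rw [h2 v, h2 w, hvw]

/-- The differential of the left translation by `x` depends continuously on `x`, and so does its
inverse. -/
theorem continuous_inverse_fderiv_mul_left [LieGroup 𝓘(ℝ, E) ∞ E] [FiniteDimensional ℝ E] :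
    Continuous fun x : E => (fderiv ℝ (fun y : E => x * y) 1).inverse := by
  have : CompleteSpace E := FiniteDimensional.complete ℝ E
  have hc : Continuous fun x : E => fderiv ℝ (fun y : E => x * y) 1 := by
    refine continuous_clm_apply.2 fun v => ?_
    have h := continuous_leftField (E := E) v
    rwa [show leftField (E := E) v = fun x => fderiv ℝ (fun y : E => x * y) 1 v from
      funext fun x => leftField_eq_fderiv v x] at h
  refine continuous_iff_continuousAt.2 fun x => ?_
  let e := (LinearEquiv.ofInjectiveEndo (fderiv ℝ (fun y : E => x * y) 1 : E →ₗ[ℝ] E)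
    (fderiv_mul_left_injective x)).toContinuousLinearEquiv
  have he : (e : E →L[ℝ] E) = fderiv ℝ (fun y : E => x * y) 1 := by
    ext v
    rfl
  have h1 := (contDiffAt_map_inverse (n := 0) e).continuousAt
  rw [he] at h1
  exact ContinuousAt.comp (f := fun x : E => fderiv ℝ (fun y : E => x * y) 1)
    (g := ContinuousLinearMap.inverse) h1 hc.continuousAt

theorem inverse_fderiv_mul_left_apply [LieGroup 𝓘(ℝ, E) ∞ E] [FiniteDimensional ℝ E] (x : E)
    (v : GroupLieAlgebra 𝓘(ℝ, E) E) :
    (fderiv ℝ (fun y : E => x * y) 1).inverse (leftField v x) = v := by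
  let e := (LinearEquiv.ofInjectiveEndo (fderiv ℝ (fun y : E => x * y) 1 : E →ₗ[ℝ] E)
    (fderiv_mul_left_injective x)).toContinuousLinearEquiv
  have he : (e : E →L[ℝ] E) = fderiv ℝ (fun y : E => x * y) 1 := by
    ext v
    rfl
  rw [leftField_eq_fderiv, ← he, ContinuousLinearMap.inverse_equiv]
  exact e.symm_apply_apply v

variable [Fintype ι]

/-- A `C¹_H` curve solves its control equation at every time, with controls that are continuous
and vanish where the velocity does: the controls are the coordinates of the velocity in the left
invariant frame. -/
theorem IsC1H.exists_continuousOn_controls [LieGroup 𝓘(ℝ, E) ∞ E] [FiniteDimensional ℝ E]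
    {X : ι → GroupLieAlgebra 𝓘(ℝ, E) E} (hX : LinearIndependent ℝ X) {Γ : ℝ → E} {a b : ℝ}
    (hab : a < b) (hΓ : IsC1H X Γ a b) :
    ∃ u : ι → ℝ → ℝ, (∀ i, ContinuousOn (u i) (Icc a b)) ∧
      (∀ t ∈ Icc a b, HasDerivWithinAt Γ (∑ i, u i t • leftField (X i) (Γ t)) (Icc a b) t) ∧
      ∀ t, derivWithin Γ (Icc a b) t = 0 → ∀ i, u i t = 0 := by
  obtain ⟨⟨w, hw⟩, hC⟩ := hΓ
  have hud := uniqueDiffOn_Icc hab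
  have hcont : ContinuousOn Γ (Icc a b) := hC.continuousOn
  have hdc : ContinuousOn (derivWithin Γ (Icc a b)) (Icc a b) :=
    hC.continuousOn_derivWithin hud le_rfl
  -- coordinates with respect to `X`
  let Y : ι → E := X
  obtain ⟨ξ, hξ⟩ := LinearMap.exists_leftInverse_of_injective (Fintype.linearCombination ℝ Y)
    (LinearMap.ker_eq_bot.2 (LinearIndependent.fintypeLinearCombination_injective hX))
  set c : ℝ → E := fun t =>
    (fderiv ℝ (fun y : E => Γ t * y) 1).inverse (derivWithin Γ (Icc a b) t) with hc
  have hcc : ContinuousOn c (Icc a b) :=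
    (continuous_inverse_fderiv_mul_left.comp_continuousOn hcont).clm_apply hdc
  set u : ι → ℝ → ℝ := fun i t => ξ (c t) i with hu
  have huc : ∀ i, ContinuousOn (u i) (Icc a b) := fun i =>
    (continuous_apply i).comp_continuousOn
      (ξ.continuous_of_finiteDimensional.comp_continuousOn hcc)
  have hae : derivWithin Γ (Icc a b) =ᵐ[volume.restrict (Icc a b)]
      fun t => ∑ i, u i t • leftField (X i) (Γ t) := by
    refine (ae_restrict_iff' measurableSet_Icc).2 ?_
    filter_upwards [hw.hasDerivAt] with t ht hmem
    have hd := ht (by rwa [uIcc_of_le hab.le])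
    have hd' := hd.hasDerivWithinAt.derivWithin (hud t hmem)
    have hct : c t = Fintype.linearCombination ℝ Y fun i => w i t := by
      simp only [hc]
      rw [hd', map_sum, Fintype.linearCombination_apply]
      refine Finset.sum_congr rfl fun i _ => ?_
      rw [map_smul, inverse_fderiv_mul_left_apply]
    rw [hd']
    refine Finset.sum_congr rfl fun i _ => ?_
    congr 1
    simp only [hu]
    rw [hct, ← LinearMap.comp_apply, hξ, LinearMap.id_apply]
  have heq := Measure.eqOn_Icc_of_ae_eq volume hab.ne hae hdc
    (continuousOn_finsetSum _ fun i _ =>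
      (huc i).smul ((continuous_leftField (X i)).comp_continuousOn hcont))
  refine ⟨u, huc, fun t ht => ?_, fun t ht i => ?_⟩
  · have h := ((hC.differentiableOn one_ne_zero) t ht).hasDerivWithinAt
    rwa [heq ht] at h
  · simp [hu, hc, ht]

/-- Conversely, a `C¹` curve that solves the control equation with continuous controls is
horizontal, with these controls. -/
theorem isHorizontalWith_of_continuousOn {X : ι → GroupLieAlgebra 𝓘(ℝ, E) E} {Γ : ℝ → E} {a b : ℝ}
    (hab : a ≤ b) {u : ι → ℝ → ℝ} (hΓ : ContDiffOn ℝ 1 Γ (Icc a b))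
    (hu : ∀ i, ContinuousOn (u i) (Icc a b))
    (hd : ∀ t ∈ Icc a b, HasDerivWithinAt Γ (∑ i, u i t • leftField (X i) (Γ t)) (Icc a b) t) :
    IsHorizontalWith X Γ a b u where
  absCont := by
    rw [← uIcc_of_le hab] at hΓ
    exact hΓ.absolutelyContinuousOnInterval
  integrable i := (hu i).intervalIntegrable_of_Icc hab
  hasDerivAt := by
    have h1 : ∀ᵐ t : ℝ ∂volume, t ≠ a := by simp [ae_iff]
    have h2 : ∀ᵐ t : ℝ ∂volume, t ≠ b := by simp [ae_iff]
    filter_upwards [h1, h2] with t hta htb ht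
    rw [uIcc_of_le hab] at ht
    exact (hd t ht).hasDerivAt
      (Icc_mem_nhds (lt_of_le_of_ne ht.1 hta.symm) (lt_of_le_of_ne ht.2 htb))

/-- Reparametrisations of `C¹_H` curves by `C¹` functions, monotone or not, are `C¹_H`. -/
theorem IsC1H.comp [LieGroup 𝓘(ℝ, E) ∞ E] [FiniteDimensional ℝ E]
    {X : ι → GroupLieAlgebra 𝓘(ℝ, E) E} (hX : LinearIndependent ℝ X) {Γ : ℝ → E} {a b c d : ℝ}
    (hab : a < b) (hcd : c ≤ d) (hΓ : IsC1H X Γ a b) {φ : ℝ → ℝ} (hφ : ContDiff ℝ 1 φ)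
    (hmaps : ∀ t, φ t ∈ Icc a b) : IsC1H X (Γ ∘ φ) c d := by
  obtain ⟨u, hu, hd, -⟩ := hΓ.exists_continuousOn_controls hX hab
  have hC : ContDiffOn ℝ 1 (Γ ∘ φ) (Icc c d) := hΓ.2.comp hφ.contDiffOn fun t _ => hmaps t
  refine ⟨⟨fun i t => deriv φ t * u i (φ t), isHorizontalWith_of_continuousOn hcd hC
    (fun i => ?_) fun t _ => ?_⟩, hC⟩
  · exact ((hφ.continuous_deriv le_rfl).mul
      ((hu i).comp_continuous hφ.continuous hmaps)).continuousOn
  · have hφ' := ((hφ.differentiable one_ne_zero) t).hasDerivAt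
    have := (hd _ (hmaps t)).scomp_hasDerivAt t hφ' hmaps
    simp only [mul_smul, ← Finset.smul_sum]
    exact this.hasDerivWithinAt

/-! ### Hausdorff measure of images -/

theorem hausdorffMeasure_image_le_of_lipschitzOnWith [LieGroup 𝓘(ℝ, E) ∞ E]
    [FiniteDimensional ℝ E] {X : ι → GroupLieAlgebra 𝓘(ℝ, E) E}
    {Γ : ℝ → E} {s : Set ℝ} {K : ℝ≥0} (h : LipschitzOnWith K (fun t => toCC X (Γ t)) s) :
    Measure.hausdorffMeasure 1 (toCC X '' (Γ '' s)) ≤ K * volume s := by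
  have := h.hausdorffMeasure_image_le (d := 1) zero_le_one
  rwa [hausdorffMeasure_real, ENNReal.rpow_one, ← image_image (toCC X) Γ] at this

/-- A curve whose horizontal speed is at most `K` is `K`-Lipschitz. -/
theorem IsHorizontalWith.lipschitzOnWith [LieGroup 𝓘(ℝ, E) ∞ E]
    [FiniteDimensional ℝ E] {X : ι → GroupLieAlgebra 𝓘(ℝ, E) E} {Γ : ℝ → E}
    {a b : ℝ} {u : ι → ℝ → ℝ} (h : IsHorizontalWith X Γ a b u) {K : ℝ≥0}
    (hK : ∀ t ∈ Icc a b, speed u t ≤ K) :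
    LipschitzOnWith K (fun t => toCC X (Γ t)) (Icc a b) := by
  have main : ∀ s ∈ Icc a b, ∀ t ∈ Icc a b, s ≤ t →
      edist (toCC X (Γ s)) (toCC X (Γ t)) ≤ K * edist s t := by
    intro s hs t ht hst
    have hI : uIcc s t ⊆ uIcc a b := (uIcc_subset_Icc hs ht).trans Icc_subset_uIcc
    refine (ccDist_le hst (h.mono hI)).trans ?_
    have h1 : (∫ r in s..t, speed u r) ≤ K * (t - s) := by
      have := intervalIntegral.integral_mono_on hst
        (intervalIntegrable_speed (h.mono hI).integrable)
        intervalIntegrable_const fun r hr => hK r ⟨hs.1.trans hr.1, hr.2.trans ht.2⟩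
      simpa [mul_comm] using this
    rw [edist_dist s t, Real.dist_eq, abs_sub_comm, abs_of_nonneg (sub_nonneg.2 hst),
      ← ENNReal.ofReal_coe_nnreal, ← ENNReal.ofReal_mul K.coe_nonneg]
    exact ENNReal.ofReal_le_ofReal h1
  intro s hs t ht
  rcases le_total s t with hst | hst
  · exact main s hs t ht hst
  · rw [edist_comm, edist_comm s]
    exact main t ht s hs hst

/-- The critical values of a `C¹_H` curve form a null set for the one-dimensional Hausdorff measure:
a short piece of the curve that contains a critical point has small speed. -/
theorem IsC1H.hausdorffMeasure_critical [LieGroup 𝓘(ℝ, E) ∞ E]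
    [FiniteDimensional ℝ E] {X : ι → GroupLieAlgebra 𝓘(ℝ, E) E}
    (hX : LinearIndependent ℝ X) {Γ : ℝ → E} (hΓ : IsC1H X Γ 0 1) :
    Measure.hausdorffMeasure 1
      (toCC X '' (Γ '' {t ∈ Icc 0 1 | derivWithin Γ (Icc 0 1) t = 0})) = 0 := by
  obtain ⟨u, hu, hd, hu0⟩ := hΓ.exists_continuousOn_controls hX zero_lt_one
  have hh := isHorizontalWith_of_continuousOn zero_le_one hΓ.2 hu hd
  have hsc : ContinuousOn (speed u) (Icc 0 1) :=
    Real.continuous_sqrt.comp_continuousOn (continuousOn_finsetSum _ fun i _ => (hu i).pow 2)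
  refine le_antisymm (ENNReal.le_of_forall_pos_le_add fun ε hε _ => ?_) zero_le
  rw [zero_add]
  obtain ⟨δ, hδ, H⟩ := Metric.uniformContinuousOn_iff.1
    (isCompact_Icc.uniformContinuousOn_of_continuous hsc) ε (by exact_mod_cast hε)
  obtain ⟨N, hN⟩ := exists_nat_one_div_lt hδ
  have hN0 : (0 : ℝ) < N + 1 := by positivity
  set Z := {t ∈ Icc (0 : ℝ) 1 | derivWithin Γ (Icc 0 1) t = 0} with hZ
  set J : Fin (N + 1) → Set ℝ := fun k => Icc ((k : ℝ) / (N + 1)) (((k : ℝ) + 1) / (N + 1)) with hJ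
  have hJsub : ∀ k, J k ⊆ Icc 0 1 := fun k => Icc_subset_Icc (by positivity) <| by
    rw [div_le_one hN0]
    exact_mod_cast k.2
  have hcover : Z ⊆ ⋃ k, J k ∩ Z := by
    intro t ht
    rcases ht.1.2.eq_or_lt with rfl | ht1
    · refine mem_iUnion.2 ⟨Fin.last N, ⟨?_, ?_⟩, ht⟩
      · rw [div_le_one hN0, Fin.val_last]
        linarith
      · rw [Fin.val_last, div_self hN0.ne']
    · have h0 : 0 ≤ t * (N + 1) := mul_nonneg ht.1.1 hN0.le
      have hk : ⌊t * (N + 1)⌋₊ < N + 1 := by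
        rw [Nat.floor_lt h0]
        push_cast
        nlinarith
      refine mem_iUnion.2 ⟨⟨_, hk⟩, ⟨?_, ?_⟩, ht⟩
      · rw [div_le_iff₀ hN0]
        exact Nat.floor_le h0
      · rw [le_div_iff₀ hN0]
        exact (Nat.lt_floor_add_one _).le
  have hpiece : ∀ k, Measure.hausdorffMeasure 1 (toCC X '' (Γ '' (J k ∩ Z))) ≤
      ENNReal.ofReal (ε / (N + 1)) := by
    intro k
    rcases (J k ∩ Z).eq_empty_or_nonempty with he | ⟨z, hz⟩
    · simp [he]
    have hJle : (k : ℝ) / (N + 1) ≤ ((k : ℝ) + 1) / (N + 1) :=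
      div_le_div_of_nonneg_right (by linarith) hN0.le
    have hlen : ((k : ℝ) + 1) / (N + 1) - (k : ℝ) / (N + 1) = 1 / (N + 1) := by ring
    have hlip : LipschitzOnWith ε (fun t => toCC X (Γ t)) (J k) := by
      refine (hh.mono ?_).lipschitzOnWith fun t ht => ?_
      · rw [uIcc_of_le hJle, uIcc_of_le zero_le_one]
        exact hJsub k
      · have h1 := H t (hJsub k ht) z (hJsub k hz.1)
          ((Real.dist_le_of_mem_Icc ht hz.1).trans_lt (by rwa [hlen]))
        have h2 : speed u z = 0 := by simp [speed, hu0 z hz.2.2]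
        rw [h2, Real.dist_eq, sub_zero, abs_of_nonneg (speed_nonneg u t)] at h1
        exact h1.le
    refine (measure_mono (image_mono (image_mono inter_subset_left))).trans
      ((hausdorffMeasure_image_le_of_lipschitzOnWith hlip).trans (le_of_eq ?_))
    rw [hJ, Real.volume_Icc, hlen, ← ENNReal.ofReal_coe_nnreal, ← ENNReal.ofReal_mul ε.coe_nonneg]
    congr 1
    ring
  calc Measure.hausdorffMeasure 1 (toCC X '' (Γ '' Z))
      ≤ Measure.hausdorffMeasure 1 (⋃ k, toCC X '' (Γ '' (J k ∩ Z))) := by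
        refine measure_mono ?_
        rw [← image_iUnion, ← image_iUnion]
        exact image_mono (image_mono hcover)
    _ ≤ ∑ k, Measure.hausdorffMeasure 1 (toCC X '' (Γ '' (J k ∩ Z))) :=
        measure_iUnion_fintype_le _ _
    _ ≤ ∑ _k : Fin (N + 1), ENNReal.ofReal (ε / (N + 1)) := Finset.sum_le_sum fun k _ => hpiece k
    _ = ε := by
        rw [Finset.sum_const, Finset.card_univ, Fintype.card_fin, nsmul_eq_mul,
          ← ENNReal.ofReal_natCast, ← ENNReal.ofReal_mul (by positivity),
          ← ENNReal.ofReal_coe_nnreal]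
        congr 1
        push_cast
        field_simp

/-! ### Lipschitz curves are Lipschitz for the norm -/

/-- Near a point, the norm is controlled by the Carnot-Carathéodory distance. The minimum takes care
of the points that a short curve cannot reach without leaving the unit ball. -/
theorem ofReal_min_norm_sub_le_ccDist {X : ι → GroupLieAlgebra 𝓘(ℝ, E) E} {x : E} {C : ℝ}
    (hC0 : 0 < C) (hC : ∀ z ∈ Metric.closedBall x 1, ∀ (u : ι → ℝ → ℝ) (t : ℝ),
      ‖∑ i, u i t • leftField (X i) z‖ ≤ C * speed u t) (y : E) :
    ENNReal.ofReal (min 1 ‖y - x‖) ≤ ENNReal.ofReal C * ccDist X x y := by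
  set r := min 1 ‖y - x‖ with hr
  have hr0 : 0 ≤ r := le_min zero_le_one (norm_nonneg _)
  rw [mul_comm, ← ENNReal.div_le_iff (by simpa using hC0) ENNReal.ofReal_ne_top]
  refine le_sInf ?_
  rintro l ⟨a, b, γ, u, hab, hγ, ha, hb, rfl⟩
  rw [← ENNReal.ofReal_div_of_pos hC0]
  refine ENNReal.ofReal_le_ofReal ?_
  rw [div_le_iff₀' hC0]
  -- the first time at which the curve reaches the distance `r`
  set S := {t ∈ Icc a b | r ≤ ‖γ t - x‖} with hS
  have hcont : ContinuousOn γ (Icc a b) := by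
    have := hγ.absCont.continuousOn
    rwa [uIcc_of_le hab] at this
  have hSc : IsClosed S :=
    ((hcont.sub continuousOn_const).norm).preimage_isClosed_of_isClosed isClosed_Icc isClosed_Ici
  have hSne : S.Nonempty := ⟨b, ⟨hab, le_rfl⟩, by rw [hb]; exact min_le_right _ _⟩
  have hSb : BddBelow S := ⟨a, fun t ht => ht.1.1⟩
  have ht₀ := hSc.csInf_mem hSne hSb
  set t₀ := sInf S
  have hsub : uIcc a t₀ ⊆ uIcc a b := by
    rw [uIcc_of_le ht₀.1.1, uIcc_of_le hab]
    exact Icc_subset_Icc_right ht₀.1.2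
  have hle := (hγ.mono hsub).norm_sub_le (C := C) ht₀.1.1 fun t ht => by
    refine hC _ ?_ u t
    rw [mem_closedBall_iff_norm]
    by_contra hcon
    exact absurd (csInf_le hSb ⟨⟨ht.1.le, ht.2.le.trans ht₀.1.2⟩,
      (min_le_left _ _).trans (not_le.1 hcon).le⟩) (not_le.2 ht.2)
  rw [ha] at hle
  have hmono : (∫ t in a..t₀, speed u t) ≤ ∫ t in a..b, speed u t :=
    intervalIntegral.integral_mono_interval le_rfl ht₀.1.1 ht₀.1.2
      (Filter.Eventually.of_forall fun t => speed_nonneg u t)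
      (intervalIntegrable_speed hγ.integrable)
  exact ht₀.2.trans (hle.trans (mul_le_mul_of_nonneg_left hmono hC0.le))

theorem min_norm_sub_le_of_lipschitzOnWith [LieGroup 𝓘(ℝ, E) ∞ E]
    [FiniteDimensional ℝ E] {X : ι → GroupLieAlgebra 𝓘(ℝ, E) E} {γ : ℝ → E}
    {K : ℝ≥0} {S : Set ℝ} (hγ : LipschitzOnWith K (fun t => toCC X (γ t)) S) {t : ℝ} (ht : t ∈ S)
    {C : ℝ} (hC0 : 0 < C) (hC : ∀ z ∈ Metric.closedBall (γ t) 1, ∀ (u : ι → ℝ → ℝ) (r : ℝ),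
      ‖∑ i, u i r • leftField (X i) z‖ ≤ C * speed u r) {s : ℝ} (hs : s ∈ S) :
    min 1 ‖γ s - γ t‖ ≤ C * K * |s - t| := by
  have h1 := ofReal_min_norm_sub_le_ccDist hC0 hC (γ s)
  have h2 : ccDist X (γ t) (γ s) ≤ K * edist t s := hγ ht hs
  have h3 := h1.trans (mul_le_mul_right h2 _)
  rw [edist_dist, dist_comm, Real.dist_eq, ← ENNReal.ofReal_coe_nnreal,
    ← ENNReal.ofReal_mul K.coe_nonneg, ← ENNReal.ofReal_mul hC0.le,
    ENNReal.ofReal_le_ofReal_iff (by positivity)] at h3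
  linarith

/-- A curve on a compact set that is Lipschitz for the Carnot-Carathéodory distance is Lipschitz for
the norm. It is first shown to be continuous, so that its image is bounded and the constants can be
chosen uniformly. -/
theorem exists_lipschitzOnWith_norm [LieGroup 𝓘(ℝ, E) ∞ E]
    [FiniteDimensional ℝ E] {X : ι → GroupLieAlgebra 𝓘(ℝ, E) E} {γ : ℝ → E}
    {K : ℝ≥0} {S : Set ℝ} (hS : IsCompact S)
    (hγ : LipschitzOnWith K (fun t => toCC X (γ t)) S) :
    ∃ L : ℝ≥0, LipschitzOnWith L γ S := by
  have hcont : ContinuousOn γ S := by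
    intro t ht
    obtain ⟨C, hC0, hC⟩ := exists_bound X (γ t) 1
    rw [Metric.continuousWithinAt_iff]
    intro ε hε
    refine ⟨min ε 1 / (C * K + 1), by positivity, fun s hs hst => ?_⟩
    have h1 := min_norm_sub_le_of_lipschitzOnWith hγ ht hC0 hC hs
    rw [Real.dist_eq, lt_div_iff₀ (by positivity)] at hst
    have h2 : min 1 ‖γ s - γ t‖ < min ε 1 := by nlinarith [abs_nonneg (s - t)]
    rw [dist_eq_norm]
    rcases min_lt_iff.1 h2 with h | h
    · exact absurd h (not_lt.2 (min_le_right _ _))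
    · exact h.trans_le (min_le_left _ _)
  have hbdd := (hS.image_of_continuousOn hcont).isBounded
  obtain ⟨R, hR⟩ := hbdd.subset_closedBall 0
  obtain ⟨C, hC0, hC⟩ := exists_bound X 0 (R + 1)
  have hD := fun s (hs : s ∈ S) t (ht : t ∈ S) => Metric.dist_le_diam_of_mem hbdd
    (mem_image_of_mem γ hs) (mem_image_of_mem γ ht)
  set D := max 1 (Metric.diam (γ '' S)) with hDdef
  refine ⟨⟨D * (C * K), by positivity⟩, LipschitzOnWith.of_dist_le_mul fun s hs t ht => ?_⟩
  have h1 := min_norm_sub_le_of_lipschitzOnWith hγ ht hC0 (fun z hz => hC z ?_) hs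
  · rw [Real.dist_eq, dist_eq_norm]
    change ‖γ s - γ t‖ ≤ D * (C * K) * |s - t|
    have h2 : ‖γ s - γ t‖ ≤ D := by
      rw [← dist_eq_norm]
      exact (hD s hs t ht).trans (le_max_right _ _)
    have hD1 : 1 ≤ D := le_max_left _ _
    have h3 : ‖γ s - γ t‖ ≤ D * min 1 ‖γ s - γ t‖ := by
      rcases min_cases 1 ‖γ s - γ t‖ with ⟨h, -⟩ | ⟨h, -⟩ <;> rw [h]
      · linarith
      · nlinarith [norm_nonneg (γ s - γ t)]
    rw [mul_assoc]
    exact h3.trans (mul_le_mul_of_nonneg_left h1 (by positivity))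
  · have h2 := hR (mem_image_of_mem γ ht)
    have := Metric.closedBall_subset_closedBall' (x := γ t) (y := 0) (ε₁ := 1) (ε₂ := R + 1)
      (by rw [Metric.mem_closedBall] at h2; linarith)
    exact this hz

end

/-! ### Intersections with a `C¹_H` curve -/

/-- A `C¹` function that is the identity near `s₀` and has values in a given ball around `s₀`. -/
theorem exists_contDiff_eq_id_near (s₀ : ℝ) {r R : ℝ} (hr : 0 < r) (hrR : r < R) :
    ∃ ψ : ℝ → ℝ, ContDiff ℝ 1 ψ ∧ (∀ s, ψ s ∈ Metric.closedBall s₀ R) ∧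
      ∀ s ∈ Metric.closedBall s₀ r, ψ s = s := by
  let χ : ContDiffBump s₀ := ⟨r, R, hr, hrR⟩
  refine ⟨fun s => s₀ + χ s * (s - s₀), ?_, fun s => ?_, fun s hs => ?_⟩
  · have : ContDiff ℝ 1 χ := χ.contDiff
    fun_prop
  · rw [Metric.mem_closedBall, Real.dist_eq, add_sub_cancel_left, abs_mul,
      abs_of_nonneg χ.nonneg]
    rcases le_or_gt R (dist s s₀) with h | h
    · rw [χ.zero_of_le_dist h, zero_mul]
      exact (hr.trans hrR).le
    · exact (mul_le_of_le_one_left (abs_nonneg _) χ.le_one).trans h.le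
  · beta_reduce
    rw [χ.one_of_mem_closedBall hs]
    ring

variable {E : Type*} [NormedAddCommGroup E] [NormedSpace ℝ E] [Group E]
  [LieGroup 𝓘(ℝ, E) ∞ E] [FiniteDimensional ℝ E] {ι : Type*} [Fintype ι]

/-- Near a regular point, `Γ` is bi-Lipschitz onto its image, so `γ = Γ ∘ σ` with `σ` Lipschitz on
the set of times at which `γ` meets this piece of `Γ`. If this set had positive measure, `σ` could
be replaced by a `C¹` function, which gives a `C¹_H` curve that agrees with `γ` too often. -/
theorem hausdorffMeasure_inter_image_closedBall_eq_zero {X : ι → GroupLieAlgebra 𝓘(ℝ, E) E}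
    (hX : LinearIndependent ℝ X) {γ Γ : ℝ → E} (hγ : IsLipschitzCurve X γ)
    (hγ_meet : ∀ Γ : ℝ → E, IsC1H X Γ 0 1 → volume {t ∈ Icc (0 : ℝ) 1 | Γ t = γ t} = 0)
    (hΓ : IsC1H X Γ 0 1) {s₀ : ℝ} (hs₀ : s₀ ∈ Ioo 0 1) (hd : derivWithin Γ (Icc 0 1) s₀ ≠ 0) :
    ∃ r > 0, Measure.hausdorffMeasure 1
      (toCC X '' (γ '' Icc 0 1 ∩ Γ '' Metric.closedBall s₀ r)) = 0 := by
  obtain ⟨K, hK⟩ := hγ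
  obtain ⟨L, hL⟩ := exists_lipschitzOnWith_norm isCompact_Icc hK
  have hnhds : Icc (0 : ℝ) 1 ∈ nhds s₀ := Icc_mem_nhds hs₀.1 hs₀.2
  rw [derivWithin_of_mem_nhds hnhds] at hd
  set c := ‖deriv Γ s₀‖ / 2 with hc
  have hc0 : 0 < c := half_pos (norm_pos_iff.2 hd)
  -- strict differentiability makes `Γ` expand distances near `s₀` by a factor at least `c`
  have hstrict : HasStrictDerivAt Γ (deriv Γ s₀) s₀ :=
    (hΓ.2.contDiffAt hnhds).hasStrictDerivAt one_ne_zero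
  have hanti := hstrict.isLittleO.def hc0
  rw [nhds_prod_eq, Filter.eventually_iff, Metric.nhds_basis_ball.prod_self.mem_iff] at hanti
  obtain ⟨R₁, hR₁, hanti⟩ := hanti
  obtain ⟨R₂, hR₂, hball⟩ := Metric.nhds_basis_closedBall.mem_iff.1 hnhds
  set r := min R₁ R₂ / 2 with hr
  have hmin : 0 < min R₁ R₂ := lt_min hR₁ hR₂
  have hr0 : 0 < r := half_pos hmin
  have hrR₁ : r < R₁ := (half_lt_self hmin).trans_le (min_le_left _ _)
  have hrR₂ : r < R₂ := (half_lt_self hmin).trans_le (min_le_right _ _)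
  set J := Metric.closedBall s₀ r with hJ
  have hJI : J ⊆ Icc 0 1 := (Metric.closedBall_subset_closedBall hrR₂.le).trans hball
  have hexp : ∀ s ∈ J, ∀ s' ∈ J, c * |s - s'| ≤ ‖Γ s - Γ s'‖ := by
    intro s hs s' hs'
    have h : ‖Γ s - Γ s' - (s - s') • deriv Γ s₀‖ ≤ c * ‖s - s'‖ :=
      hanti (mk_mem_prod (Metric.closedBall_subset_ball hrR₁ hs)
        (Metric.closedBall_subset_ball hrR₁ hs'))
    have h1 := norm_sub_norm_le ((s - s') • deriv Γ s₀) (Γ s - Γ s')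
    rw [norm_sub_rev ((s - s') • deriv Γ s₀), norm_smul] at h1
    rw [Real.norm_eq_abs] at h h1
    have h2 : ‖deriv Γ s₀‖ = 2 * c := by rw [hc]; ring
    rw [h2] at h1
    linarith
  set A := Icc (0 : ℝ) 1 ∩ γ ⁻¹' (Γ '' J) with hA
  have hAm : MeasurableSet A := by
    have : IsCompact (Γ '' J) :=
      (isCompact_closedBall s₀ r).image_of_continuousOn (hΓ.2.continuousOn.mono hJI)
    exact (hL.continuousOn.preimage_isClosed_of_isClosed isClosed_Icc this.isClosed).measurableSet
  have hA0 : volume A = 0 := by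
    by_contra hne
    have hσ : ∀ t, ∃ s, t ∈ A → s ∈ J ∧ Γ s = γ t := fun t => by
      by_cases ht : t ∈ A
      · obtain ⟨s, hs, hst⟩ := ht.2
        exact ⟨s, fun _ => ⟨hs, hst⟩⟩
      · exact ⟨0, fun h => absurd h ht⟩
    choose σ hσ using hσ
    have hσL : LipschitzOnWith (L / ⟨c, hc0.le⟩) σ A := by
      refine LipschitzOnWith.of_dist_le_mul fun t ht t' ht' => ?_
      have h1 := hexp _ (hσ t ht).1 _ (hσ t' ht').1
      rw [(hσ t ht).2, (hσ t' ht').2, ← dist_eq_norm] at h1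
      have h2 := h1.trans (hL.dist_le_mul t ht.1 t' ht'.1)
      rw [Real.dist_eq (σ t)]
      change |σ t - σ t'| ≤ L / c * dist t t'
      rw [div_mul_eq_mul_div, le_div_iff₀ hc0]
      linarith
    obtain ⟨σ', hσ', hσσ'⟩ := hσL.extend_real
    obtain ⟨g, hg, hgA⟩ := exists_contDiff_volume_eq_ne_zero hσ' hAm hne
      (ne_top_of_le_ne_top (by simp) (measure_mono inter_subset_left))
    obtain ⟨ψ, hψ, hψR, hψJ⟩ := exists_contDiff_eq_id_near s₀ hr0 hrR₂
    have hcomp : IsC1H X (Γ ∘ (ψ ∘ g)) 0 1 :=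
      hΓ.comp hX zero_lt_one zero_le_one (hψ.comp hg) fun t => hball (hψR _)
    refine hgA (measure_mono_null (fun t ht => ?_) (hγ_meet _ hcomp))
    refine ⟨ht.1.1, ?_⟩
    have h1 : g t = σ t := by rw [ht.2, hσσ' ht.1]
    have h2 := hσ t ht.1
    simp only [Function.comp]
    rw [h1, hψJ _ h2.1, h2.2]
  refine ⟨r, hr0, measure_mono_null (image_mono ?_) (le_antisymm
    ((hausdorffMeasure_image_le_of_lipschitzOnWith (hK.mono inter_subset_left)).trans
      (by rw [hA0, mul_zero])) zero_le : Measure.hausdorffMeasure 1 (toCC X '' (γ '' A)) = 0)⟩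
  rintro _ ⟨⟨t, ht, rfl⟩, hs⟩
  exact ⟨t, ⟨ht, hs⟩, rfl⟩

theorem isPurelyC1HUnrectifiable_image {X : ι → GroupLieAlgebra 𝓘(ℝ, E) E}
    (hX : LinearIndependent ℝ X) {γ : ℝ → E} (hγ : IsLipschitzCurve X γ)
    (hγ_meet : ∀ Γ : ℝ → E, IsC1H X Γ 0 1 → volume {t ∈ Icc (0 : ℝ) 1 | Γ t = γ t} = 0) :
    IsPurelyC1HUnrectifiable X (γ '' Icc 0 1) := by
  intro Γ hΓ
  set U := {s ∈ Ioo (0 : ℝ) 1 | derivWithin Γ (Icc 0 1) s ≠ 0} with hU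
  have hloc : ∀ s, ∃ r > 0, s ∈ U → Measure.hausdorffMeasure 1
      (toCC X '' (γ '' Icc 0 1 ∩ Γ '' Metric.closedBall s r)) = 0 := fun s => by
    by_cases hs : s ∈ U
    · obtain ⟨r, hr, h⟩ :=
        hausdorffMeasure_inter_image_closedBall_eq_zero hX hγ hγ_meet hΓ hs.1 hs.2
      exact ⟨r, hr, fun _ => h⟩
    · exact ⟨1, one_pos, fun h => absurd h hs⟩
  choose r hr hnull using hloc
  obtain ⟨T, hTU, hT, hcover⟩ := TopologicalSpace.countable_cover_nhdsWithin
    (f := fun s => Metric.closedBall s (r s)) (s := U)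
    fun s _ => mem_nhdsWithin_of_mem_nhds (Metric.closedBall_mem_nhds s (hr s))
  have hreg : Measure.hausdorffMeasure 1
      (⋃ s ∈ T, toCC X '' (γ '' Icc 0 1 ∩ Γ '' Metric.closedBall s (r s))) = 0 :=
    (measure_biUnion_null_iff hT).2 fun s hs => hnull s (hTU hs)
  have : NullSingletonClass (Measure.hausdorffMeasure 1 : Measure (CCSpace X)) :=
    Measure.nullSingletonClass_hausdorff _ one_pos
  have hends : Measure.hausdorffMeasure 1 ({toCC X (Γ 0), toCC X (Γ 1)} : Set (CCSpace X)) = 0 :=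
    (Set.toFinite _).measure_zero _
  refine measure_mono_null ?_
    (measure_union_null (measure_union_null hreg (hΓ.hausdorffMeasure_critical hX)) hends)
  rintro _ ⟨_, ⟨hyγ, s, hs, rfl⟩, rfl⟩
  by_cases hz : derivWithin Γ (Icc 0 1) s = 0
  · exact Or.inl (Or.inr ⟨_, ⟨s, ⟨hs, hz⟩, rfl⟩, rfl⟩)
  rcases hs.1.eq_or_lt with rfl | h0
  · exact Or.inr (Or.inl rfl)
  rcases hs.2.eq_or_lt with rfl | h1
  · exact Or.inr (Or.inr rfl)
  obtain ⟨s', hs', hss'⟩ := mem_iUnion₂.1 (hcover ⟨⟨h0, h1⟩, hz⟩)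
  exact Or.inl (Or.inl (mem_iUnion₂.2 ⟨s', hs', _, ⟨hyγ, s, hss', rfl⟩, rfl⟩))

end Carnot

theorem theorem4p1 {n m s : ℕ} [Group (EuclideanSpace ℝ (Fin n))]
    [LieGroup 𝓘(ℝ, EuclideanSpace ℝ (Fin n)) ∞ (EuclideanSpace ℝ (Fin n))]
    (V : ℕ → Submodule ℝ
      (GroupLieAlgebra 𝓘(ℝ, EuclideanSpace ℝ (Fin n)) (EuclideanSpace ℝ (Fin n))))
    (hV : Carnot.IsStratification s V) (X : Module.Basis (Fin m) ℝ (V 1))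
    (γ : ℝ → EuclideanSpace ℝ (Fin n))
    (hγ : Carnot.IsLipschitzCurve (fun i => (X i).val) γ)
    (hγ_meet : ∀ Γ : ℝ → EuclideanSpace ℝ (Fin n), Carnot.IsC1H (fun i => (X i).val) Γ 0 1 →
      MeasureTheory.volume {t ∈ Set.Icc (0 : ℝ) 1 | Γ t = γ t} = 0) :
    Carnot.IsPurelyC1HUnrectifiable (fun i => (X i).val) (γ '' Set.Icc 0 1) := by
  exact Carnot.isPurelyC1HUnrectifiable_image
    (X.linearIndependent.map' (V 1).subtype (Submodule.ker_subtype _)) hγ hγ_meet
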